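/- Let $K$ be a field of characteristic $0$, let $\beta\in K$ (for instance $K=\mathbb{Q}(\beta)$ with $\beta$ an indeterminate), and let $1\le r\le n$ be integers. For parameters $q,t$ let $$D_n^r=t^{r(r-1)/2}\sum_{I\subseteq\{1,\dots,n\},\,|I|=r}\ \prod_{i\in I,\,j\notin I}\frac{t x_i-x_j}{x_i-x_j}\ \prod_{i\in I}T_{q,x_i},\qquad (T_{q,x_i}f)(x_1,\dots,x_n)=f(x_1,\dots,qx_i,\dots,x_n),$$ be the Macdonald operator. Let $$d_i=x_i\partial_{x_i}+\beta\sum_{j\ne i}\frac{x_i}{x_i-x_j}(1-K_{i,j}),\qquad H_k=\sum_{i=1}^n d_i^{\,k}$$ be the Dunkl operators, where $K_{i,j}$ interchanges the variables $x_i$ and $x_j$. Put $q=\exp(h)$ and $t=\exp(\beta h)$ as formal power series in $h$, and let $D_n^r(h^3)$ denote the coefficient of $h^3$ in $D_n^r$, as an operator on the symmetric polynomials in $x_1,\dots,x_n$ over $K$. Theorem. (a) If $n\ge 3$, then on symmetric polynomials $$\begin{aligned}D_n^r(h^3)={}&\frac16\binom{n-3}{r-2}\frac{n-2r}{r-1}\,H_3+\frac12\binom{n-3}{r-2}H_2H_1+\frac{n^2(3r-1)-7rn+6r}{12(n-2)}\binom{n-2}{r-1}\beta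 H_2\\&+\frac16\binom{n-3}{r-3}H_1^3+\frac{\beta}{12}\binom{n-3}{r-1}\frac{(3r^2-3r+1)n^2+(-9r^2+6r)n+8r^2-6r}{(n-r)(n-r-1)}H_1^2\\&+\frac{\beta^2r}{24}\bigl((3r+1)n^2+(1-7r)n+2r\bigr)\binom{n-1}{r-1}H_1+\beta^3\binom nr\frac{r^2n(n-1)}{48}\bigl((r+1)n+1-3r\bigr).\end{aligned}$$ Here $\binom ab=0$ if $b<0$ or $b>a$; for $r=1$ the expression $\binom{n-3}{r-2}\frac{n-2r}{r-1}$ is understood as $1$, the value for $r=1$, after cancellation of $n-2$, of the form $\binom{n-3}{r-1}\frac{n-2r}{n-r-1}$ of the same coefficient; and $\binom{n-3}{r-1}\frac1{(n-r)(n-r-1)}$ is understood, for $r\in\{n-1,n\}$, as $\binom{n-1}{r-1}\frac1{(n-1)(n-2)}$, to which it is equal for $r\le n-2$. (b) For $r=1$ and $r=2$ the formula, with common factors of its coefficients cancelled, holds for all $n\ge r$ (including $n=1,2$): on symmetric polynomials, $$D_n^1(h^3)=\frac16H_3+\frac{2n-3}{12}\beta H_2+\frac{\beta}{12}H_1^2+\frac{(n-1)(2n-1)}{12}\beta^2H_1+\frac{n^2(n-1)^2}{24}\beta^3\qquad(n\ge1),$$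 $$\begin{aligned}D_n^2(h^3)={}&\frac{n-4}6H_3+\frac12H_2H_1+\frac{5n^2-14n+12}{12}\beta H_2+\frac{7n-10}{12}\beta H_1^2\\&+\frac{(n-1)(7n^2-13n+4)}{12}\beta^2H_1+\frac{n^2(n-1)^2(3n-5)}{24}\beta^3\qquad(n\ge2).\end{aligned}$$ -/

import Mathlib

namespace DunklMacdonald

open MvPolynomial

noncomputable section

/-! ### Dunkl operators on polynomials in `x_0, …, x_{n-1}` -/

/-- The exchange operator `K_{i,j}`: it interchanges the variables `x_i` and `x_j`. -/
def exchange {n : ℕ} {K : Type*} [Field K] (i j : Fin n) :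
    MvPolynomial (Fin n) K →ₐ[K] MvPolynomial (Fin n) K :=
  rename (Equiv.swap i j)

theorem sub_dvd_sub_exchange {n : ℕ} {K : Type*} [Field K] (i j : Fin n)
    (f : MvPolynomial (Fin n) K) :
    (X i - X j : MvPolynomial (Fin n) K) ∣ f - exchange i j f := by
  induction f using MvPolynomial.induction_on with
  | C a => simp [exchange]
  | add p q hp hq =>
    have h := dvd_add hp hq
    rw [map_add]
    convert h using 1
    ring
  | mul_X p k hp =>
    have hk : (X i - X j : MvPolynomial (Fin n) K) ∣ X k - X (Equiv.swap i j k) := by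
      rcases eq_or_ne k i with rfl | hki
      · simp
      rcases eq_or_ne k j with rfl | hkj
      · rw [Equiv.swap_apply_right, ← neg_sub]
        exact (neg_dvd.mpr (dvd_refl (X k - X i : MvPolynomial (Fin n) K)))
      · simp [Equiv.swap_apply_of_ne_of_ne hki hkj]
    have hX : exchange i j (X k : MvPolynomial (Fin n) K) = X (Equiv.swap i j k) := by
      simp [exchange]
    have h := dvd_add (Dvd.dvd.mul_right hp (X k)) (Dvd.dvd.mul_left hk (exchange i j p))
    rw [map_mul, hX]
    convert h using 1
    ring

theorem X_sub_X_ne_zero {n : ℕ} {K : Type*} [Field K] {i j : Fin n} (hij : i ≠ j) :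
    (X i - X j : MvPolynomial (Fin n) K) ≠ 0 :=
  sub_ne_zero.mpr fun h => hij (X_injective h)

/-- For `i ≠ j`, the operator `(x_i - x_j)⁻¹ (1 - K_{i,j})`: it sends `f` to the unique polynomial
`g` with `(x_i - x_j) g = f - K_{i,j} f`. (For `i = j` it is `0`, by convention.) -/
def exchangeQuotient {n : ℕ} {K : Type*} [Field K] (i j : Fin n) :
    MvPolynomial (Fin n) K →ₗ[K] MvPolynomial (Fin n) K where
  toFun f := if i = j then 0 else (sub_dvd_sub_exchange i j f).choose
  map_add' f g := by
    by_cases hij : i = j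
    · simp [hij]
    · simp only [hij, if_false]
      apply mul_left_cancel₀ (X_sub_X_ne_zero (K := K) hij)
      rw [mul_add, ← (sub_dvd_sub_exchange i j f).choose_spec,
        ← (sub_dvd_sub_exchange i j g).choose_spec,
        ← (sub_dvd_sub_exchange i j (f + g)).choose_spec, map_add]
      ring
  map_smul' c f := by
    by_cases hij : i = j
    · simp [hij]
    · simp only [hij, if_false, RingHom.id_apply]
      apply mul_left_cancel₀ (X_sub_X_ne_zero (K := K) hij)
      rw [mul_smul_comm, ← (sub_dvd_sub_exchange i j f).choose_spec,
        ← (sub_dvd_sub_exchange i j (c • f)).choose_spec, map_smul, smul_sub]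

theorem mul_exchangeQuotient {n : ℕ} {K : Type*} [Field K] {i j : Fin n} (hij : i ≠ j)
    (f : MvPolynomial (Fin n) K) :
    (X i - X j) * exchangeQuotient i j f = f - exchange i j f := by
  simp only [exchangeQuotient, LinearMap.coe_mk, AddHom.coe_mk, hij, if_false]
  exact (sub_dvd_sub_exchange i j f).choose_spec.symm

/-- Multiplication by the variable `x_i`. -/
def mulX {n : ℕ} {K : Type*} [Field K] (i : Fin n) : Module.End K (MvPolynomial (Fin n) K) :=
  LinearMap.mulLeft K (X i)

/-- `d_i = x_i ∂_i + β ∑_{j ≠ i} x_i / (x_i - x_j) (1 - K_{i,j})`. -/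
def dunkl {n : ℕ} {K : Type*} [Field K] (β : K) (i : Fin n) :
    Module.End K (MvPolynomial (Fin n) K) :=
  mulX i * (pderiv i).toLinearMap +
    β • ∑ j ∈ Finset.univ.erase i, mulX i * exchangeQuotient i j

/-- The `k`-th Dunkl operator `H_k = ∑_i d_i ^ k`. -/
def dunklH {n : ℕ} {K : Type*} [Field K] (β : K) (k : ℕ) :
    Module.End K (MvPolynomial (Fin n) K) :=
  ∑ i, dunkl β i ^ k

/-! ### Macdonald operators over formal power series in `h` -/

/-- The field `K(x_0, …, x_{n-1})`. -/
abbrev RatFun (n : ℕ) (K : Type*) [Field K] : Type _ := FractionRing (MvPolynomial (Fin n) K)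

/-- The variable `x_i` as a rational function. -/
def var {n : ℕ} (K : Type*) [Field K] (i : Fin n) : RatFun n K :=
  algebraMap (MvPolynomial (Fin n) K) (RatFun n K) (X i)

/-- The inclusion `K⟦h⟧ → K(x)⟦h⟧`. -/
def scalar (n : ℕ) {K : Type*} [Field K] : PowerSeries K →+* PowerSeries (RatFun n K) :=
  PowerSeries.map (algebraMap K (RatFun n K))

/-- The action of `∏_{i ∈ I} T_{q,x_i}` on `f`: the variables `x_i` with `i ∈ I` are replaced by
`q x_i`. -/
def qShift {n : ℕ} {K : Type*} [Field K] (q : PowerSeries K) (I : Finset (Fin n))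
    (f : MvPolynomial (Fin n) K) : PowerSeries (RatFun n K) :=
  aeval (fun i => if i ∈ I then scalar n q * PowerSeries.C (var K i)
    else PowerSeries.C (var K i)) f

/-- The Macdonald operator
`D_n^r = t^{r(r-1)/2} ∑_{|I| = r} ∏_{i ∈ I, j ∉ I} (t x_i - x_j)/(x_i - x_j) ∏_{i ∈ I} T_{q,x_i}`,
for parameters `q, t ∈ K⟦h⟧`, applied to a polynomial `f`. -/
def macdonald {n : ℕ} {K : Type*} [Field K] (q t : PowerSeries K) (r : ℕ)
    (f : MvPolynomial (Fin n) K) : PowerSeries (RatFun n K) :=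
  scalar n t ^ (r * (r - 1) / 2) *
    ∑ I ∈ (Finset.univ : Finset (Fin n)).powersetCard r,
      (∏ i ∈ I, ∏ j ∈ Iᶜ,
        (scalar n t * PowerSeries.C (var K i) - PowerSeries.C (var K j)) *
          PowerSeries.C (var K i - var K j)⁻¹) * qShift q I f

/-- The `m`-th order of `D_n^r`: the coefficient of `h^m` after the substitution `q = exp(h)`,
`t = exp(βh)`. -/
def macdonaldOrder {n : ℕ} {K : Type*} [Field K] [CharZero K] (β : K) (m r : ℕ)
    (f : MvPolynomial (Fin n) K) : RatFun n K :=
  PowerSeries.coeff m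
    (macdonald (PowerSeries.exp K) (PowerSeries.rescale β (PowerSeries.exp K)) r f)

/-! ### The coefficients -/

/-- The binomial coefficient `a` over `b`, equal to `0` if `b < 0` or `b > a`. -/
def binom (a : ℕ) (b : ℤ) : ℚ := if 0 ≤ b then (a.choose b.toNat : ℚ) else 0

/-- `(1/6) binom(n-3, r-2) (n-2r)/(r-1)`. For `r = 1`, where this reads `0/0`, it stands for the
other form `(1/6) binom(n-3, r-1) (n-2r)/(n-r-1)` of the same number, that is for `1/6`; see
`coeffH3_eq`. (For `n ≥ 3`.) -/
def coeffH3 (n r : ℕ) : ℚ :=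
  if r = 1 then 1 / 6 else 1 / 6 * binom (n - 3) (r - 2) * ((n - 2 * r) / (r - 1))

/-- `(1/12) binom(n-3, r-1) ((3r²-3r+1)n² + (-9r²+6r)n + 8r²-6r) / ((n-r)(n-r-1))`, where
`binom(n-3, r-1) / ((n-r)(n-r-1))` is written as `binom(n-1, r-1) / ((n-1)(n-2))`, which also makes
sense for `r = n-1` and `r = n`; see `coeffH1Sq_eq`. (For `n ≥ 3`.) -/
def coeffH1Sq (n r : ℕ) : ℚ :=
  1 / 12 * (binom (n - 1) (r - 1) / ((n - 1) * (n - 2))) *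
    ((3 * r ^ 2 - 3 * r + 1) * n ^ 2 + (-9 * r ^ 2 + 6 * r) * n + 8 * r ^ 2 - 6 * r)

theorem binom_of_nat (a b : ℕ) : binom a b = a.choose b := by simp [binom]

theorem coeffH3_eq (n r : ℕ) (hn : 3 ≤ n) (hr : 1 ≤ r) (hrn : r + 2 ≤ n) :
    coeffH3 n r = 1 / 6 * binom (n - 3) (r - 1) * ((n - 2 * r) / (n - r - 1)) := by
  obtain ⟨s, rfl⟩ := Nat.exists_eq_add_of_le hr
  obtain ⟨m, rfl⟩ := Nat.exists_eq_add_of_le hrn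
  have hm : (1 + s + 2 + m) - 3 = s + m := by omega
  have e1 : ((1 + s : ℕ) : ℤ) - 1 = (s : ℕ) := by push_cast; ring
  rw [coeffH3, hm, e1, binom_of_nat]
  have hd : ((1 + s + 2 + m : ℕ) : ℚ) - (1 + s : ℕ) - 1 = m + 1 := by push_cast; ring
  rw [hd]
  have hm0 : (m : ℚ) + 1 ≠ 0 := by positivity
  rcases Nat.eq_zero_or_pos s with rfl | hs
  · simp
    field_simp
    ring
  · obtain ⟨u, rfl⟩ := Nat.exists_eq_add_of_le' hs
    have e2 : ((1 + (u + 1) : ℕ) : ℤ) - 2 = (u : ℕ) := by push_cast; ring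
    rw [e2, binom_of_nat, if_neg (by omega)]
    have key : ((u + 1 + m).choose (u + 1) : ℚ) * (u + 1) =
        ((u + 1 + m).choose u : ℚ) * (m + 1) := by
      have := Nat.choose_succ_right_eq (u + 1 + m) u
      have h2 : u + 1 + m - u = m + 1 := by omega
      rw [h2] at this
      exact_mod_cast this
    have hd2 : ((1 + (u + 1) : ℕ) : ℚ) - 1 = u + 1 := by push_cast; ring
    rw [hd2]
    have hu0 : (u : ℚ) + 1 ≠ 0 := by positivity
    have key2 : ((u + 1 + m).choose (u + 1) : ℚ) / (m + 1) =
        ((u + 1 + m).choose u : ℚ) / (u + 1) := by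
      rw [div_eq_div_iff hm0 hu0, key]
    linear_combination (-1 / 6 : ℚ) *
      (((1 + (u + 1) + 2 + m : ℕ) : ℚ) - 2 * (1 + (u + 1) : ℕ)) * key2

theorem coeffH1Sq_eq (n r : ℕ) (hr : 1 ≤ r) (hrn : r + 2 ≤ n) :
    coeffH1Sq n r = 1 / 12 * binom (n - 3) (r - 1) *
      (((3 * r ^ 2 - 3 * r + 1) * n ^ 2 + (-9 * r ^ 2 + 6 * r) * n + 8 * r ^ 2 - 6 * r) /
        ((n - r) * (n - r - 1))) := by
  obtain ⟨s, rfl⟩ := Nat.exists_eq_add_of_le hr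
  obtain ⟨m, rfl⟩ := Nat.exists_eq_add_of_le hrn
  have hm : (1 + s + 2 + m) - 3 = s + m := by omega
  have hm' : (1 + s + 2 + m) - 1 = s + m + 2 := by omega
  have e1 : ((1 + s : ℕ) : ℤ) - 1 = (s : ℕ) := by push_cast; ring
  rw [coeffH1Sq, hm, hm', e1, binom_of_nat, binom_of_nat]
  have k1 : ((s + m + 1).choose s : ℚ) * (m + 1) = (s + m).choose s * (s + m + 1) := by
    have := Nat.choose_mul_succ_eq (s + m) s
    have h2 : s + m + 1 - s = m + 1 := by omega
    rw [h2] at this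
    exact_mod_cast this.symm
  have k2 : ((s + m + 2).choose s : ℚ) * (m + 2) = (s + m + 1).choose s * (s + m + 2) := by
    have := Nat.choose_mul_succ_eq (s + m + 1) s
    have h2 : s + m + 1 + 1 - s = m + 2 := by omega
    rw [h2] at this
    exact_mod_cast this.symm
  have key : ((s + m + 2).choose s : ℚ) / ((s + m + 2) * (s + m + 1)) =
      (s + m).choose s / ((m + 2) * (m + 1)) := by
    rw [div_eq_div_iff (by positivity) (by positivity)]
    linear_combination (m + 1 : ℚ) * k2 + (s + m + 2 : ℚ) * k1
  have a1 : ((1 + s + 2 + m : ℕ) : ℚ) - 1 = s + m + 2 := by push_cast; ring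
  have a2 : ((1 + s + 2 + m : ℕ) : ℚ) - 2 = s + m + 1 := by push_cast; ring
  have a3 : ((1 + s + 2 + m : ℕ) : ℚ) - (1 + s : ℕ) = m + 2 := by push_cast; ring
  have a4 : (m : ℚ) + 2 - 1 = m + 1 := by ring
  rw [a1, a2, a3, a4, key]
  ring

end

end DunklMacdonald

open DunklMacdonald

/-!
Put `y_ij = x_i / (x_i - x_j)`, so that `y_ij + y_ji = 1`, and let `E = ∑ x_i ∂_i`. The third order
of the Macdonald operator is the sum over `|I| = r` of a term `F(I)`, the coefficient of `h³` in
the weight of `I` times `exp (h ∑_{i ∈ I} x_i ∂_i) f`. The antisymmetry of `y_ij - 1/2` and the factor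
`t ^ (r (r - 1) / 2)` make the logarithm of the weight equal to `β h ∑_{i ∈ I} ∑_j y_ij` at first
order (`hasLogCoeffs_weight`). At second order it is quadratic in the indicator variables
`[i ∈ I]`, and at third order of degree at most two. So `F(I)` is a polynomial of degree at most `3`
in the indicator variables, without constant term (`orderTerm_three_mem_subsetPoly`), and the
number of `I` that contain a given set depends only on the size of that set. Hence the sum of `F`
over the `r`-element sets is an explicit combination of its sums over the sets of size `1`, `n - 1`
and `n` (`sum_powersetCard_eq`).

For `I` the full set the weight is a power of `t`. For the complement of `{i}` the term is that of
`{i}` with `h` replaced by `-h`, composed with `exp (h (N + E))`, `N = β n (n - 1) / 2`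
(`orderTerm_three_compl_singleton`); so only the orders up to `3` of the operator for `r = 1` are
needed. They are compared with `H_2` and `H_3`, written as differential operators on symmetric
polynomials (`toRat_dunklH_two`, `toRat_dunklH_three`). Two identities enter: the three-term
relation `y_jk y_ji + y_kj y_ki + y_ij y_ik = 1`, for the first-order part of `H_3`, and
`∑_i ∏_{j ≠ i} (t x_i - x_j) / (x_i - x_j) = 1 + t + ⋯ + t ^ (n - 1)`, a case of Lagrange
interpolation, for the constant terms.
-/

namespace DunklMacdonald

/-! ### Power series with constant term `1`, up to third order -/

/-- The power series `P` agrees with `exp (b₁ h + b₂ h² + b₃ h³)` up to and including the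
third order in `h`. -/
structure HasLogCoeffs {L : Type*} [Field L] (P : PowerSeries L) (b₁ b₂ b₃ : L) : Prop where
  coeff_zero : PowerSeries.coeff 0 P = 1
  coeff_one : PowerSeries.coeff 1 P = b₁
  coeff_two : PowerSeries.coeff 2 P = b₁ ^ 2 / 2 + b₂
  coeff_three : PowerSeries.coeff 3 P = b₁ ^ 3 / 6 + b₁ * b₂ + b₃

section PowerSeriesCoeff

variable {R : Type*} [CommSemiring R] (P Q : PowerSeries R)

theorem coeff_zero_mul_eq : PowerSeries.coeff 0 (P * Q) =
    PowerSeries.coeff 0 P * PowerSeries.coeff 0 Q := by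
  simp [PowerSeries.coeff_mul]

theorem coeff_one_mul_eq : PowerSeries.coeff 1 (P * Q) =
    PowerSeries.coeff 0 P * PowerSeries.coeff 1 Q +
      PowerSeries.coeff 1 P * PowerSeries.coeff 0 Q := by
  rw [PowerSeries.coeff_mul, Finset.Nat.sum_antidiagonal_eq_sum_range_succ_mk]
  simp [Finset.sum_range_succ]

theorem coeff_two_mul_eq : PowerSeries.coeff 2 (P * Q) =
    PowerSeries.coeff 0 P * PowerSeries.coeff 2 Q +
      PowerSeries.coeff 1 P * PowerSeries.coeff 1 Q +
      PowerSeries.coeff 2 P * PowerSeries.coeff 0 Q := by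
  rw [PowerSeries.coeff_mul, Finset.Nat.sum_antidiagonal_eq_sum_range_succ_mk]
  simp [Finset.sum_range_succ]

theorem coeff_three_mul_eq : PowerSeries.coeff 3 (P * Q) =
    PowerSeries.coeff 0 P * PowerSeries.coeff 3 Q +
      PowerSeries.coeff 1 P * PowerSeries.coeff 2 Q +
      PowerSeries.coeff 2 P * PowerSeries.coeff 1 Q +
      PowerSeries.coeff 3 P * PowerSeries.coeff 0 Q := by
  rw [PowerSeries.coeff_mul, Finset.Nat.sum_antidiagonal_eq_sum_range_succ_mk]
  simp [Finset.sum_range_succ]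

end PowerSeriesCoeff

namespace HasLogCoeffs

variable {L : Type*} [Field L]

theorem one : HasLogCoeffs (1 : PowerSeries L) 0 0 0 := by
  constructor <;> simp [PowerSeries.coeff_one]

theorem mul [CharZero L] {P Q : PowerSeries L} {b₁ b₂ b₃ c₁ c₂ c₃ : L}
    (hP : HasLogCoeffs P b₁ b₂ b₃) (hQ : HasLogCoeffs Q c₁ c₂ c₃) :
    HasLogCoeffs (P * Q) (b₁ + c₁) (b₂ + c₂) (b₃ + c₃) := by
  constructor
  · rw [coeff_zero_mul_eq, hP.coeff_zero, hQ.coeff_zero, one_mul]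
  · rw [coeff_one_mul_eq, hP.coeff_zero, hQ.coeff_zero, hP.coeff_one, hQ.coeff_one]
    ring
  · rw [coeff_two_mul_eq, hP.coeff_zero, hQ.coeff_zero, hP.coeff_one, hQ.coeff_one,
      hP.coeff_two, hQ.coeff_two]
    field_simp
    ring
  · rw [coeff_three_mul_eq, hP.coeff_zero, hQ.coeff_zero, hP.coeff_one, hQ.coeff_one,
      hP.coeff_two, hQ.coeff_two, hP.coeff_three, hQ.coeff_three]
    field_simp
    ring

theorem prod [CharZero L] {ι : Type*} (s : Finset ι) {P : ι → PowerSeries L} {b₁ b₂ b₃ : ι → L}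
    (h : ∀ i ∈ s, HasLogCoeffs (P i) (b₁ i) (b₂ i) (b₃ i)) :
    HasLogCoeffs (∏ i ∈ s, P i) (∑ i ∈ s, b₁ i) (∑ i ∈ s, b₂ i) (∑ i ∈ s, b₃ i) := by
  classical
  induction s using Finset.induction_on with
  | empty => simpa using one
  | insert a s ha ih =>
    simp only [Finset.prod_insert ha, Finset.sum_insert ha]
    exact (h a (Finset.mem_insert_self a s)).mul
      (ih fun i hi => h i (Finset.mem_insert_of_mem hi))

theorem pow [CharZero L] {P : PowerSeries L} {b₁ b₂ b₃ : L} (h : HasLogCoeffs P b₁ b₂ b₃)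
    (m : ℕ) : HasLogCoeffs (P ^ m) (m * b₁) (m * b₂) (m * b₃) := by
  simpa using prod (Finset.range m) (P := fun _ => P) fun _ _ => h

end HasLogCoeffs

section Exponential

variable {n : ℕ} {K : Type*} [Field K]

instance [CharZero K] : CharZero (RatFun n K) :=
  charZero_of_injective_algebraMap (algebraMap K (RatFun n K)).injective

/-- The element `β` of `K`, as a rational function. -/
noncomputable def const (n : ℕ) {K : Type*} [Field K] (β : K) : RatFun n K :=
  algebraMap K (RatFun n K) β

theorem coeff_scalar_exp [CharZero K] (β : K) (m : ℕ) :
    PowerSeries.coeff m (scalar n (PowerSeries.rescale β (PowerSeries.exp K))) =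
      const n β ^ m / (m.factorial : RatFun n K) := by
  simp [scalar, const, PowerSeries.coeff_exp, PowerSeries.coeff_rescale, div_eq_mul_inv]

theorem hasLogCoeffs_scalar_exp [CharZero K] (β : K) :
    HasLogCoeffs (scalar n (PowerSeries.rescale β (PowerSeries.exp K))) (const n β) 0 0 := by
  constructor <;> rw [coeff_scalar_exp] <;> simp [Nat.factorial]

/-- The ratio `x_i / (x_i - x_j)`; it is `0` for `i = j`. -/
noncomputable def ratio (K : Type*) [Field K] (i j : Fin n) : RatFun n K :=
  var K i * (var K i - var K j)⁻¹

theorem ratio_self (i : Fin n) : ratio K i i = 0 := by simp [ratio]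

theorem var_injective : Function.Injective (var K : Fin n → RatFun n K) :=
  (IsFractionRing.injective _ _).comp MvPolynomial.X_injective

theorem var_sub_var_ne_zero {i j : Fin n} (hij : i ≠ j) : var K i - var K j ≠ 0 :=
  sub_ne_zero.mpr fun h => hij (var_injective h)

theorem ratio_add_ratio {i j : Fin n} (hij : i ≠ j) : ratio K i j + ratio K j i = 1 := by
  have h₁ := var_sub_var_ne_zero (K := K) hij
  have h₂ := var_sub_var_ne_zero (K := K) hij.symm
  rw [ratio, ratio]
  field_simp
  ring

theorem weight_factor_eq (t : PowerSeries K) {i j : Fin n} (hij : i ≠ j) :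
    (scalar n t * PowerSeries.C (var K i) - PowerSeries.C (var K j)) *
      PowerSeries.C (var K i - var K j)⁻¹ =
      1 + (scalar n t - 1) * PowerSeries.C (ratio K i j) := by
  have h : PowerSeries.C (var K i - var K j) * PowerSeries.C (var K i - var K j)⁻¹ =
      (1 : PowerSeries (RatFun n K)) := by
    rw [← map_mul, mul_inv_cancel₀ (var_sub_var_ne_zero hij), map_one]
  rw [map_sub] at h
  rw [ratio, map_mul]
  linear_combination h

theorem hasLogCoeffs_weight_factor [CharZero K] (β : K) {i j : Fin n} (hij : i ≠ j) :
    HasLogCoeffs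
      ((scalar n (PowerSeries.rescale β (PowerSeries.exp K)) * PowerSeries.C (var K i) -
        PowerSeries.C (var K j)) * PowerSeries.C (var K i - var K j)⁻¹)
      (const n β * ratio K i j) (const n β ^ 2 / 2 * (ratio K i j - ratio K i j ^ 2))
      (const n β ^ 3 / 6 * (ratio K i j - 3 * ratio K i j ^ 2 + 2 * ratio K i j ^ 3)) := by
  rw [weight_factor_eq _ hij]
  constructor <;>
    simp only [map_add, map_sub, PowerSeries.coeff_mul_C, coeff_scalar_exp,
      PowerSeries.coeff_one, Nat.factorial] <;> norm_num <;> field_simp <;> ring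

end Exponential

/-! ### Functions of a subset of bounded degree in its indicator variables -/

section SubsetFunctions

variable {ι : Type*} [DecidableEq ι] {L : Type*} [Field L]

/-- The function of a finite set `I` equal to `1` if `S ⊆ I` and to `0` otherwise: the product of
the indicator variables `[i ∈ I]`, `i ∈ S`. -/
def subsetMonomial (L : Type*) [Field L] (S : Finset ι) : Finset ι → L :=
  fun I => if S ⊆ I then 1 else 0

/-- The functions of a finite set `I` that are polynomials of degree at most `d`, without constant
term, in the indicator variables `[i ∈ I]`. -/
def subsetPoly (ι : Type*) [DecidableEq ι] (L : Type*) [Field L] (d : ℕ) :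
    Submodule L (Finset ι → L) :=
  Submodule.span L (subsetMonomial L '' {S | S.Nonempty ∧ S.card ≤ d})

theorem subsetMonomial_mem {S : Finset ι} (hS : S.Nonempty) {d : ℕ} (hd : S.card ≤ d) :
    subsetMonomial L S ∈ subsetPoly ι L d :=
  Submodule.subset_span ⟨S, ⟨hS, hd⟩, rfl⟩

theorem subsetPoly_mono {d e : ℕ} (h : d ≤ e) : subsetPoly ι L d ≤ subsetPoly ι L e :=
  Submodule.span_mono (Set.image_mono fun _ hS => ⟨hS.1, hS.2.trans h⟩)

theorem subsetMonomial_mul (S T : Finset ι) :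
    subsetMonomial L S * subsetMonomial L T = subsetMonomial L (S ∪ T) := by
  funext I
  simp only [subsetMonomial, Pi.mul_apply, Finset.union_subset_iff]
  split_ifs <;> simp_all

theorem mul_mem_subsetPoly {d e : ℕ} {F G : Finset ι → L} (hF : F ∈ subsetPoly ι L d)
    (hG : G ∈ subsetPoly ι L e) : F * G ∈ subsetPoly ι L (d + e) := by
  have h := Submodule.mul_mem_mul hF hG
  rw [subsetPoly, subsetPoly, Submodule.span_mul_span] at h
  refine Submodule.span_le.mpr ?_ h
  rintro _ ⟨_, ⟨S, hS, rfl⟩, _, ⟨T, hT, rfl⟩, rfl⟩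
  simp only [subsetMonomial_mul]
  exact subsetMonomial_mem (hS.1.mono Finset.subset_union_left)
    ((Finset.card_union_le S T).trans (Nat.add_le_add hS.2 hT.2))

theorem sum_mem_subsetPoly [Fintype ι] (a : ι → L) :
    (fun I : Finset ι => ∑ i ∈ I, a i) ∈ subsetPoly ι L 1 := by
  have h : (fun I : Finset ι => ∑ i ∈ I, a i) = ∑ i, a i • subsetMonomial L {i} := by
    funext I
    simp [subsetMonomial, Finset.sum_apply]
  rw [h]
  exact Submodule.sum_mem _ fun i _ =>
    Submodule.smul_mem _ _ (subsetMonomial_mem (Finset.singleton_nonempty i) (by simp))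

theorem sum_mul_mem_subsetPoly [Fintype ι] {d : ℕ} {c : ι → Finset ι → L}
    (h : ∀ i, c i ∈ subsetPoly ι L d) :
    (fun I : Finset ι => ∑ i ∈ I, c i I) ∈ subsetPoly ι L (1 + d) := by
  have e : (fun I : Finset ι => ∑ i ∈ I, c i I) = ∑ i, subsetMonomial L {i} * c i := by
    funext I
    simp [subsetMonomial, Finset.sum_apply]
  rw [e]
  exact Submodule.sum_mem _ fun i _ => mul_mem_subsetPoly
    (subsetMonomial_mem (Finset.singleton_nonempty i) (by simp)) (h i)

theorem sum_sum_mem_subsetPoly [Fintype ι] (a : ι → ι → L) :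
    (fun I : Finset ι => ∑ i ∈ I, ∑ j ∈ I, a i j) ∈ subsetPoly ι L 2 :=
  sum_mul_mem_subsetPoly (d := 1) (c := fun i I => ∑ j ∈ I, a i j) fun i =>
    sum_mem_subsetPoly (a i)

theorem sum_sum_sum_mem_subsetPoly [Fintype ι] (a : ι → ι → ι → L) :
    (fun I : Finset ι => ∑ i ∈ I, ∑ j ∈ I, ∑ k ∈ I, a i j k) ∈ subsetPoly ι L 3 :=
  sum_mul_mem_subsetPoly (d := 2) (c := fun i I => ∑ j ∈ I, ∑ k ∈ I, a i j k) fun i =>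
    sum_sum_mem_subsetPoly (a i)

theorem sum_sum_compl_mem_subsetPoly [Fintype ι] (a : ι → ι → L) :
    (fun I : Finset ι => ∑ i ∈ I, ∑ j ∈ Iᶜ, a i j) ∈ subsetPoly ι L 2 := by
  have e : (fun I : Finset ι => ∑ i ∈ I, ∑ j ∈ Iᶜ, a i j) =
      (fun I : Finset ι => ∑ i ∈ I, ∑ j, a i j) -
        fun I : Finset ι => ∑ i ∈ I, ∑ j ∈ I, a i j := by
    funext I
    simp only [Pi.sub_apply, ← Finset.sum_sub_distrib]
    exact Finset.sum_congr rfl fun i _ => eq_sub_of_add_eq (Finset.sum_compl_add_sum I _)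
  rw [e]
  exact Submodule.sub_mem _ (subsetPoly_mono (by norm_num) (sum_mem_subsetPoly _))
    (sum_sum_mem_subsetPoly _)

theorem smul_mem_subsetPoly {d : ℕ} {F : Finset ι → L} (k : L) (hF : F ∈ subsetPoly ι L d) :
    (fun I => k * F I) ∈ subsetPoly ι L d :=
  Submodule.smul_mem _ k hF

/-- The third order of the product of `exp (b₁ h + b₂ h² + b₃ h³)` and
`f₀ + f₁ h + f₂ h² / 2 + f₃ h³ / 6`, where the degrees are bounded by the orders. -/
theorem exp_order_three_mem_subsetPoly {b₁ b₂ b₃ f₁ f₂ f₃ : Finset ι → L} (f₀ : L)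
    (hb₁ : b₁ ∈ subsetPoly ι L 1) (hb₂ : b₂ ∈ subsetPoly ι L 2) (hb₃ : b₃ ∈ subsetPoly ι L 2)
    (hf₁ : f₁ ∈ subsetPoly ι L 1) (hf₂ : f₂ ∈ subsetPoly ι L 2) (hf₃ : f₃ ∈ subsetPoly ι L 3) :
    (fun I => (b₁ I ^ 3 / 6 + b₁ I * b₂ I + b₃ I) * f₀ + (b₁ I ^ 2 / 2 + b₂ I) * f₁ I +
      b₁ I * (f₂ I / 2) + f₃ I / 6) ∈ subsetPoly ι L 3 := by
  have e : (fun I => (b₁ I ^ 3 / 6 + b₁ I * b₂ I + b₃ I) * f₀ + (b₁ I ^ 2 / 2 + b₂ I) * f₁ I +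
      b₁ I * (f₂ I / 2) + f₃ I / 6) =
      (f₀ / 6) • (b₁ * b₁ * b₁) + f₀ • (b₁ * b₂) + f₀ • b₃ + (2 : L)⁻¹ • (b₁ * b₁ * f₁) +
        b₂ * f₁ + (2 : L)⁻¹ • (b₁ * f₂) + (6 : L)⁻¹ • f₃ := by
    funext I
    simp only [Pi.add_apply, Pi.smul_apply, Pi.mul_apply, smul_eq_mul]
    ring
  have h₁₁ : b₁ * b₁ ∈ subsetPoly ι L 2 := mul_mem_subsetPoly (d := 1) (e := 1) hb₁ hb₁
  have h₁ : b₁ * b₁ * b₁ ∈ subsetPoly ι L 3 := mul_mem_subsetPoly (d := 2) (e := 1) h₁₁ hb₁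
  have h₂ : b₁ * b₂ ∈ subsetPoly ι L 3 := mul_mem_subsetPoly (d := 1) (e := 2) hb₁ hb₂
  have h₃ : b₃ ∈ subsetPoly ι L 3 := subsetPoly_mono (d := 2) (by norm_num) hb₃
  have h₄ : b₁ * b₁ * f₁ ∈ subsetPoly ι L 3 := mul_mem_subsetPoly (d := 2) (e := 1) h₁₁ hf₁
  have h₅ : b₂ * f₁ ∈ subsetPoly ι L 3 := mul_mem_subsetPoly (d := 2) (e := 1) hb₂ hf₁
  have h₆ : b₁ * f₂ ∈ subsetPoly ι L 3 := mul_mem_subsetPoly (d := 1) (e := 2) hb₁ hf₂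
  rw [e]
  refine Submodule.add_mem _ (Submodule.add_mem _ (Submodule.add_mem _ (Submodule.add_mem _
    (Submodule.add_mem _ (Submodule.add_mem _ ?_ ?_) ?_) ?_) h₅) ?_) ?_ <;>
  exact Submodule.smul_mem _ _ (by assumption)

/-- The number of `r`-element sets that contain a given `S` is a binomial coefficient. -/
theorem card_filter_subset_powersetCard [Fintype ι] (S : Finset ι) {r : ℕ} (h : S.card ≤ r) :
    ((Finset.univ.powersetCard r).filter (S ⊆ ·)).card =
      (Fintype.card ι - S.card).choose (r - S.card) := by
  rw [← Finset.card_compl, ← Finset.card_powersetCard]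
  refine Finset.card_bij' (fun I _ => I \ S) (fun J _ => J ∪ S) ?_ ?_ ?_ ?_
  · intro I hI
    simp only [Finset.mem_filter, Finset.mem_powersetCard_univ] at hI
    rw [Finset.mem_powersetCard]
    exact ⟨fun x hx => by simp_all, by rw [Finset.card_sdiff_of_subset hI.2, hI.1]⟩
  · intro J hJ
    rw [Finset.mem_powersetCard] at hJ
    simp only [Finset.mem_filter, Finset.mem_powersetCard_univ]
    have hd : Disjoint J S := Finset.disjoint_left.mpr fun x hx => by simpa using hJ.1 hx
    exact ⟨by rw [Finset.card_union_of_disjoint hd, hJ.2]; omega, Finset.subset_union_right⟩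
  · intro I hI
    simp only [Finset.mem_filter] at hI
    exact Finset.sdiff_union_of_subset hI.2
  · intro J hJ
    rw [Finset.mem_powersetCard] at hJ
    exact Finset.union_sdiff_cancel_right
      (Finset.disjoint_left.mpr fun x hx => by simpa using hJ.1 hx)

theorem card_filter_subset_powersetCard_of_lt [Fintype ι] (S : Finset ι) {r : ℕ}
    (h : r < S.card) : ((Finset.univ.powersetCard r).filter (S ⊆ ·)).card = 0 := by
  rw [Finset.card_eq_zero, Finset.filter_eq_empty_iff]
  intro I hI hS
  rw [Finset.mem_powersetCard_univ] at hI
  have := Finset.card_le_card hS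
  omega

/-- A function of `I` of degree at most `3` in the indicator variables is determined, as far as its
sums over all `I` of a given size are concerned, by its sums over the sets of size `1`, `n - 1` and
`n`. It suffices to compare the numbers of sets that contain a given set of size `m ≤ 3`. -/
theorem sum_powersetCard_eq [Fintype ι] {F : Finset ι → L} (hF : F ∈ subsetPoly ι L 3) {r : ℕ}
    {a b c : L}
    (h : ∀ m : ℕ, 1 ≤ m → m ≤ 3 → m ≤ Fintype.card ι →
      ((if m ≤ r then (Fintype.card ι - m).choose (r - m) else 0 : ℕ) : L) =
        a * (if m = 1 then 1 else 0) + b * (Fintype.card ι - m) + c) :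
    ∑ I ∈ Finset.univ.powersetCard r, F I =
      a * ∑ i, F {i} + b * ∑ i, F {i}ᶜ + c * F Finset.univ := by
  induction hF using Submodule.span_induction with
  | zero => simp
  | add F G _ _ hF hG =>
    simp only [Pi.add_apply, Finset.sum_add_distrib, hF, hG]
    ring
  | smul k F _ hF =>
    simp only [Pi.smul_apply, smul_eq_mul, ← Finset.mul_sum, hF]
    ring
  | mem F hF =>
    obtain ⟨S, ⟨hS, hd⟩, rfl⟩ := hF
    have e₁ : ∑ I ∈ Finset.univ.powersetCard r, subsetMonomial L S I =
        ((if S.card ≤ r then (Fintype.card ι - S.card).choose (r - S.card) else 0 : ℕ) : L) := by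
      simp only [subsetMonomial, Finset.sum_boole]
      split_ifs with hr
      · rw [card_filter_subset_powersetCard S hr]
      · rw [card_filter_subset_powersetCard_of_lt S (not_le.mp hr)]
    have e₂ : ∑ i, subsetMonomial L S {i} = if S.card = 1 then 1 else 0 := by
      simp only [subsetMonomial, Finset.Nonempty.subset_singleton_iff hS]
      split_ifs with h₁
      · obtain ⟨x, rfl⟩ := Finset.card_eq_one.mp h₁
        simp
      · refine Finset.sum_eq_zero fun i _ => if_neg ?_
        rintro rfl
        simp at h₁
    have e₃ : ∑ i, subsetMonomial L S {i}ᶜ = (Fintype.card ι : L) - S.card := by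
      have : ∀ i, subsetMonomial L S {i}ᶜ = 1 - if i ∈ S then 1 else 0 := by
        intro i
        have hi : S ⊆ {i}ᶜ ↔ i ∉ S := by
          rw [Finset.subset_compl_comm, Finset.singleton_subset_iff, Finset.mem_compl]
        simp only [subsetMonomial, hi]
        split_ifs <;> simp
      simp [Finset.sum_congr rfl fun i _ => this i]
    rw [e₁, e₂, e₃, h S.card hS.card_pos hd (Finset.card_le_univ S)]
    simp [subsetMonomial]

end SubsetFunctions

/-! ### Identities between the ratios `x_i / (x_i - x_j)` -/

section Ratios

variable {n : ℕ} {K : Type*} [Field K]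

/-- The sum `∑_{j ≠ i} x_i / (x_i - x_j)`. -/
noncomputable def ratioSum (K : Type*) [Field K] (i : Fin n) : RatFun n K := ∑ j, ratio K i j

theorem ratio_sub_sq_comm (i j : Fin n) :
    ratio K i j - ratio K i j ^ 2 = ratio K j i - ratio K j i ^ 2 := by
  rcases eq_or_ne i j with rfl | h
  · rfl
  · linear_combination (ratio K j i - ratio K i j) * ratio_add_ratio (K := K) h

theorem ratio_cubic_antisymm (i j : Fin n) :
    ratio K i j - 3 * ratio K i j ^ 2 + 2 * ratio K i j ^ 3 =
      -(ratio K j i - 3 * ratio K j i ^ 2 + 2 * ratio K j i ^ 3) := by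
  rcases eq_or_ne i j with rfl | h
  · simp [ratio_self]
  · rw [eq_sub_of_add_eq (ratio_add_ratio (K := K) h)]
    ring

theorem ratio_add_ratio_eq_ite (i j : Fin n) :
    ratio K i j + ratio K j i = 1 - if i = j then 1 else 0 := by
  split_ifs with h
  · simp [h, ratio_self]
  · rw [ratio_add_ratio h, sub_zero]

theorem sum_ratio_left (i : Fin n) : ∑ j, ratio K j i = n - 1 - ratioSum K i := by
  have h := Finset.sum_congr rfl fun j (_ : j ∈ Finset.univ) => ratio_add_ratio_eq_ite (K := K) i j
  simp only [Finset.sum_add_distrib, Finset.sum_sub_distrib, Finset.sum_ite_eq,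
    Finset.mem_univ, if_true] at h
  rw [ratioSum]
  simp at h
  linear_combination h

theorem two_mul_sum_ratio (I : Finset (Fin n)) :
    2 * ∑ i ∈ I, ∑ j ∈ I, ratio K i j = (I.card : RatFun n K) * (I.card - 1) := by
  have h : ∑ i ∈ I, ∑ j ∈ I, (ratio K i j + ratio K j i) =
      ∑ i ∈ I, ∑ j ∈ I, ((1 : RatFun n K) - if i = j then 1 else 0) :=
    Finset.sum_congr rfl fun i _ => Finset.sum_congr rfl fun j _ => ratio_add_ratio_eq_ite i j
  simp only [Finset.sum_add_distrib, Finset.sum_sub_distrib] at h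
  rw [Finset.sum_comm (f := fun i j => ratio K j i)] at h
  simp at h
  linear_combination h

/-- The three-term partial fraction identity. The right-hand side is `1`
for distinct `i`, `j`, `k`; its other terms account for the degenerate cases. -/
theorem ratio_mul_ratio_cyclic (i j k : Fin n) :
    ratio K j k * ratio K j i + ratio K k j * ratio K k i + ratio K i j * ratio K i k =
      (1 - (if i = j then 1 else 0) - (if i = k then 1 else 0) - (if j = k then 1 else 0) +
          2 * ((if i = j then 1 else 0) * (if i = k then 1 else 0))) +
        (if j = k then 1 else 0) * ratio K i j ^ 2 + (if i = j then 1 else 0) * ratio K k i ^ 2 +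
        (if i = k then 1 else 0) * ratio K j i ^ 2 := by
  rcases eq_or_ne i j with rfl | hij
  · rcases eq_or_ne i k with rfl | hik
    · simp [ratio_self]
      ring
    · simp [ratio_self, hik]
      ring
  · rcases eq_or_ne i k with rfl | hik
    · simp [ratio_self, hij, hij.symm]
      ring
    · rcases eq_or_ne j k with rfl | hjk
      · simp [ratio_self, hij]
        ring
      · have h₁ := var_sub_var_ne_zero (K := K) hij
        have h₂ := var_sub_var_ne_zero (K := K) hik
        have h₃ := var_sub_var_ne_zero (K := K) hjk
        have h₄ := var_sub_var_ne_zero (K := K) hij.symm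
        have h₅ := var_sub_var_ne_zero (K := K) hik.symm
        have h₆ := var_sub_var_ne_zero (K := K) hjk.symm
        have e : ratio K j i = 1 - ratio K i j := eq_sub_of_add_eq' (ratio_add_ratio hij)
        have e' : ratio K k i = 1 - ratio K i k := eq_sub_of_add_eq' (ratio_add_ratio hik)
        have e'' : ratio K k j = 1 - ratio K j k := eq_sub_of_add_eq' (ratio_add_ratio hjk)
        simp only [hij, hik, hjk, if_false]
        rw [e, e', e'']
        simp only [ratio]
        field_simp
        ring

/-- The degree-two relation between the sums of ratios, obtained by summing
`ratio_mul_ratio_cyclic` over `j` and `k`. -/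
theorem two_mul_sum_ratioSum_mul_ratio (i : Fin n) :
    2 * ∑ j, ratioSum K j * ratio K j i =
      ((n : RatFun n K) - 1) * n - 4 * ratioSum K i + 3 * ∑ j, ratio K i j ^ 2 -
        ratioSum K i ^ 2 := by
  have h := Finset.sum_congr rfl fun j (_ : j ∈ Finset.univ) =>
    Finset.sum_congr rfl fun k (_ : k ∈ Finset.univ) => ratio_mul_ratio_cyclic (K := K) i j k
  have e₁ : ∑ j, ∑ k, ratio K j k * ratio K j i = ∑ j, ratioSum K j * ratio K j i := by
    simp only [ratioSum, Finset.sum_mul]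
  have e₂ : ∑ j, ∑ k, ratio K k j * ratio K k i = ∑ j, ratioSum K j * ratio K j i := by
    rw [Finset.sum_comm, e₁]
  have e₃ : ∑ j, ∑ k, ratio K i j * ratio K i k = ratioSum K i ^ 2 := by
    rw [sq, ratioSum, Finset.sum_mul_sum]
  -- From the symmetry of `y - y ^ 2` in the two indices.
  have e₄ : ∑ j, ratio K j i ^ 2 = n - 1 - 2 * ratioSum K i + ∑ j, ratio K i j ^ 2 := by
    have h' := Finset.sum_congr rfl fun j (_ : j ∈ Finset.univ) => ratio_sub_sq_comm (K := K) i j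
    simp only [Finset.sum_sub_distrib, sum_ratio_left] at h'
    rw [← ratioSum] at h'
    linear_combination h'
  simp only [Finset.sum_add_distrib, Finset.sum_sub_distrib, e₁, e₂, e₃] at h
  simp [e₄] at h
  linear_combination h

/-- Summation by parts against the ratios. -/
theorem sum_sum_ratio_mul_sub (a : Fin n → RatFun n K) :
    ∑ i, ∑ j, ratio K i j * (a i - a j) = ∑ i, (2 * ratioSum K i - (n - 1)) * a i := by
  simp only [mul_sub, Finset.sum_sub_distrib]
  rw [Finset.sum_comm (f := fun i j => ratio K i j * a j)]
  simp only [← Finset.sum_mul, sum_ratio_left]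
  rw [← Finset.sum_sub_distrib]
  refine Finset.sum_congr rfl fun i _ => ?_
  rw [← ratioSum]
  ring

theorem sum_sum_ratio_sub_sq_mul_sub (a : Fin n → RatFun n K) :
    ∑ i, ∑ j, (ratio K i j - ratio K i j ^ 2) * (a i - a j) = 0 := by
  simp only [mul_sub, Finset.sum_sub_distrib]
  rw [sub_eq_zero, Finset.sum_comm (f := fun i j => _ * a j)]
  exact Finset.sum_congr rfl fun i _ => Finset.sum_congr rfl fun j _ => by
    rw [ratio_sub_sq_comm]

theorem two_mul_sum_sum_ratio_mul_symm (a : Fin n → Fin n → RatFun n K)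
    (ha : ∀ i j, a i j = a j i) :
    2 * ∑ i, ∑ j, ratio K i j * a i j = ∑ i, ∑ j, a i j - ∑ i, a i i := by
  have h : ∑ i, ∑ j, ratio K i j * a i j = ∑ i, ∑ j, ratio K j i * a i j := by
    rw [Finset.sum_comm]
    exact Finset.sum_congr rfl fun i _ => Finset.sum_congr rfl fun j _ => by rw [ha]
  have h' : ∑ i, ∑ j, (ratio K i j * a i j + ratio K j i * a i j) =
      ∑ i, ∑ j, (a i j - if i = j then a i j else 0) :=
    Finset.sum_congr rfl fun i _ => Finset.sum_congr rfl fun j _ => by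
      rw [← add_mul, ratio_add_ratio_eq_ite]
      split_ifs <;> ring
  simp only [Finset.sum_add_distrib, Finset.sum_sub_distrib, Finset.sum_ite_eq, Finset.mem_univ,
    if_true, ← h] at h'
  linear_combination h'

/-- A second-order analogue of `sum_sum_ratio_mul_sub`. -/
theorem sum_mul_sum_ratio_mul_sub (a : Fin n → RatFun n K) :
    ∑ i, (2 * ratioSum K i - (n - 1)) * ∑ j, ratio K i j * (a i - a j) =
      ∑ i, (3 * ratioSum K i ^ 2 - 3 * ∑ j, ratio K i j ^ 2 - 2 * (n - 1) * ratioSum K i +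
        4 * ratioSum K i - (n - 1)) * a i := by
  have h : ∀ i, (2 * ratioSum K i - (n - 1)) * ∑ j, ratio K i j * (a i - a j) =
      (2 * ratioSum K i - (n - 1)) * ratioSum K i * a i -
        ∑ j, (2 * ratioSum K i - (n - 1)) * ratio K i j * a j := by
    intro i
    simp only [mul_sub, Finset.sum_sub_distrib, ← Finset.sum_mul, Finset.mul_sum, mul_assoc]
    rw [← ratioSum]
  simp only [h, Finset.sum_sub_distrib]
  rw [Finset.sum_comm (f := fun i j => _ * ratio K i j * a j), ← Finset.sum_sub_distrib]
  refine Finset.sum_congr rfl fun i _ => ?_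
  have h' : ∑ j, (2 * ratioSum K j - (n - 1)) * ratio K j i =
      2 * ∑ j, ratioSum K j * ratio K j i - (n - 1) * ∑ j, ratio K j i := by
    simp only [sub_mul, Finset.sum_sub_distrib, mul_assoc, ← Finset.mul_sum]
  rw [← Finset.sum_mul, h', two_mul_sum_ratioSum_mul_ratio, sum_ratio_left]
  ring

end Ratios

section Lagrange

/-- Lagrange interpolation of `∏_j (τ z - x_j)` at the nodes `0, x_1, …, x_n`. -/
theorem sum_prod_mul_sub_div {L ι : Type*} [Field L] [Fintype ι] [DecidableEq ι] {x : ι → L}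
    (hx : Function.Injective x) (h0 : ∀ i, x i ≠ 0) (τ : L) :
    (τ - 1) * ∑ i, ∏ j ∈ {i}ᶜ, (τ * x i - x j) * (x i - x j)⁻¹ =
      τ ^ Fintype.card ι - 1 := by
  classical
  let v : Option ι → L := fun o => o.elim 0 x
  have hv : Set.InjOn v (Finset.univ : Finset (Option ι)) := by
    rintro (_ | i) - (_ | j) - h
    · rfl
    · exact absurd h.symm (h0 j)
    · exact absurd h (h0 i)
    · exact congrArg some (hx h)
  let P : Polynomial L := ∏ j, (Polynomial.C τ * Polynomial.X + Polynomial.C (-x j))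
  have hd : P.natDegree ≤ Fintype.card ι := by
    refine (Polynomial.natDegree_prod_le _ _).trans ?_
    refine (Finset.sum_le_card_nsmul _ _ 1 fun j _ => Polynomial.natDegree_linear_le).trans ?_
    simp
  have hP : P.degree < (Finset.univ : Finset (Option ι)).card := by
    refine Polynomial.degree_le_natDegree.trans_lt ?_
    rw [Finset.card_univ, Fintype.card_option]
    exact_mod_cast Nat.lt_succ_of_le hd
  have hc : P.coeff (Fintype.card ι) = τ ^ Fintype.card ι := by
    have := Polynomial.coeff_prod_of_natDegree_le (s := Finset.univ)
      (f := fun j => Polynomial.C τ * Polynomial.X + Polynomial.C (-x j)) (n := 1)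
      fun j _ => Polynomial.natDegree_linear_le
    simpa [P] using this
  have key := Lagrange.coeff_eq_sum hv hP
  rw [Finset.card_univ, Fintype.card_option, Nat.add_sub_cancel, hc, Fintype.sum_option] at key
  have e₀ : (Finset.univ : Finset (Option ι)).erase none = Finset.univ.map .some := by
    ext (_ | i) <;> simp
  have e₁ : ∀ i, (Finset.univ : Finset (Option ι)).erase (some i) =
      insert none (({i}ᶜ : Finset ι).map .some) := by
    intro i
    ext (_ | j) <;> simp
  have h₀ : P.eval (v none) / ∏ j ∈ Finset.univ.erase none, (v none - v j) = 1 := by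
    rw [e₀, Finset.prod_map]
    simp only [P, v, Polynomial.eval_prod]
    simp
    exact Finset.prod_ne_zero_iff.mpr fun j _ => neg_ne_zero.mpr (h0 j)
  have h₁ : ∀ i, P.eval (v (some i)) / ∏ j ∈ Finset.univ.erase (some i), (v (some i) - v j) =
      (τ - 1) * ∏ j ∈ {i}ᶜ, (τ * x i - x j) * (x i - x j)⁻¹ := by
    intro i
    rw [e₁, Finset.prod_insert (by simp), Finset.prod_map, Finset.prod_mul_distrib,
      Finset.prod_inv_distrib]
    simp only [P, v, Polynomial.eval_prod]
    rw [← Finset.mul_prod_erase _ _ (Finset.mem_univ i), ← Finset.compl_singleton]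
    simp [← sub_eq_add_neg]
    have := h0 i
    field_simp
  rw [h₀, Finset.sum_congr rfl fun i _ => h₁ i, ← Finset.mul_sum] at key
  rw [key]
  ring

theorem sum_prod_one_add_mul_ratio {n : ℕ} {K : Type*} [Field K] [CharZero K] {A : Type*}
    [CommRing A] [Algebra (RatFun n K) A] (T : A) :
    ∑ i : Fin n, ∏ j ∈ {i}ᶜ, (1 + (T - 1) * algebraMap (RatFun n K) A (ratio K i j)) =
      ∑ k ∈ Finset.range n, T ^ k := by
  have h : ∑ i : Fin n, ∏ j ∈ {i}ᶜ, (1 + ((Polynomial.X : Polynomial (RatFun n K)) - 1) *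
      Polynomial.C (ratio K i j)) = ∑ k ∈ Finset.range n, Polynomial.X ^ k := by
    -- The factor `T - 1` can be cancelled for an indeterminate `T`, but not in general.
    have h1 : (Polynomial.X : Polynomial (RatFun n K)) - 1 ≠ 0 := Polynomial.X_sub_C_ne_zero 1
    apply mul_left_cancel₀ h1
    rw [mul_geom_sum]
    refine Polynomial.funext fun τ => ?_
    have hl := sum_prod_mul_sub_div (var_injective (K := K) (n := n))
      (fun i => by simp [var, MvPolynomial.X_ne_zero]) τ
    simp only [Polynomial.eval_mul, Polynomial.eval_sub, Polynomial.eval_X, Polynomial.eval_one,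
      Polynomial.eval_finsetSum, Polynomial.eval_prod, Polynomial.eval_add, Polynomial.eval_C,
      Polynomial.eval_pow]
    rw [Fintype.card_fin] at hl
    rw [← hl]
    congr 1
    refine Finset.sum_congr rfl fun i _ => Finset.prod_congr rfl fun j hj => ?_
    have hij : i ≠ j := by
      rintro rfl
      simp at hj
    have := var_sub_var_ne_zero (K := K) hij
    rw [ratio]
    field_simp
    ring
  have := congrArg (Polynomial.aeval T) h
  simpa [map_sum, map_prod] using this

end Lagrange

open MvPolynomial

/-! ### Euler operators -/

section Euler

variable {n : ℕ} {K : Type*} [Field K]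

/-- The operator `x_i ∂_i`. -/
noncomputable def theta (i : Fin n) : Module.End K (MvPolynomial (Fin n) K) :=
  mulX i * (pderiv i).toLinearMap

/-- The operator `∑_{i ∈ I} x_i ∂_i`. -/
noncomputable def thetaSum (I : Finset (Fin n)) : Module.End K (MvPolynomial (Fin n) K) :=
  ∑ i ∈ I, theta i

theorem theta_apply (i : Fin n) (f : MvPolynomial (Fin n) K) : theta i f = X i * pderiv i f := rfl

theorem thetaSum_apply (I : Finset (Fin n)) (f : MvPolynomial (Fin n) K) :
    thetaSum I f = ∑ i ∈ I, theta i f := by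
  simp [thetaSum]

theorem theta_mul (i : Fin n) (f g : MvPolynomial (Fin n) K) :
    theta i (f * g) = theta i f * g + f * theta i g := by
  simp only [theta_apply, pderiv_mul]
  ring

theorem theta_X_self (i : Fin n) : theta i (X i : MvPolynomial (Fin n) K) = X i := by
  simp [theta_apply]

theorem theta_X_of_ne {i j : Fin n} (h : i ≠ j) :
    theta i (X j : MvPolynomial (Fin n) K) = 0 := by
  simp [theta_apply, pderiv_X_of_ne h.symm]

theorem theta_X (i j : Fin n) :
    theta i (X j : MvPolynomial (Fin n) K) = if i = j then X j else 0 := by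
  split_ifs with h
  · rw [h, theta_X_self]
  · exact theta_X_of_ne h

theorem theta_C (i : Fin n) (a : K) : theta i (C a : MvPolynomial (Fin n) K) = 0 := by
  simp [theta_apply]

theorem theta_comm (i j : Fin n) (f : MvPolynomial (Fin n) K) :
    theta i (theta j f) = theta j (theta i f) := by
  induction f using MvPolynomial.induction_on with
  | C a => simp [theta_C]
  | add p q hp hq => simp [hp, hq]
  | mul_X p k hp =>
    simp only [theta_mul, map_add, theta_X, hp]
    split_ifs <;> simp [theta_X, *]

theorem theta_rename (σ : Equiv.Perm (Fin n)) (i : Fin n) (f : MvPolynomial (Fin n) K) :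
    theta (σ i) (rename σ f) = rename σ (theta i f) := by
  simp [theta_apply, pderiv_rename σ.injective]

theorem thetaSum_mul (I : Finset (Fin n)) (f g : MvPolynomial (Fin n) K) :
    thetaSum I (f * g) = thetaSum I f * g + f * thetaSum I g := by
  simp only [thetaSum_apply, theta_mul, Finset.sum_add_distrib, Finset.sum_mul, Finset.mul_sum]

theorem thetaSum_C (I : Finset (Fin n)) (a : K) :
    thetaSum I (C a : MvPolynomial (Fin n) K) = 0 := by
  simp [thetaSum_apply, theta_C]

theorem thetaSum_X (I : Finset (Fin n)) (j : Fin n) :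
    thetaSum I (X j : MvPolynomial (Fin n) K) = if j ∈ I then X j else 0 := by
  simp [thetaSum_apply, theta_X]

theorem thetaSum_univ_isSymmetric {f : MvPolynomial (Fin n) K} (hf : f.IsSymmetric) :
    (thetaSum Finset.univ f).IsSymmetric := by
  intro σ
  simp only [thetaSum_apply, map_sum, ← theta_rename, hf σ]
  exact Equiv.sum_comp σ fun i => theta i f

theorem theta_thetaSum (i : Fin n) (I : Finset (Fin n)) (f : MvPolynomial (Fin n) K) :
    theta i (thetaSum I f) = thetaSum I (theta i f) := by
  simp only [thetaSum_apply, map_sum, theta_comm i]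

theorem thetaSum_singleton (i : Fin n) :
    (thetaSum {i} : Module.End K (MvPolynomial (Fin n) K)) = theta i := by
  simp [thetaSum]

theorem thetaSum_compl_singleton (i : Fin n) (f : MvPolynomial (Fin n) K) :
    thetaSum {i}ᶜ f = thetaSum Finset.univ f - theta i f := by
  rw [eq_sub_iff_add_eq, thetaSum_apply, thetaSum_apply,
    ← Finset.sum_compl_add_sum {i} fun j => theta j f, Finset.sum_singleton]

end Euler

/-! ### Dunkl operators on symmetric polynomials -/

section Dunkl

variable {n : ℕ} {K : Type*} [Field K]

/-- A polynomial, as a rational function. -/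
noncomputable abbrev toRat (f : MvPolynomial (Fin n) K) : RatFun n K :=
  algebraMap (MvPolynomial (Fin n) K) (RatFun n K) f

theorem toRat_injective :
    Function.Injective (toRat : MvPolynomial (Fin n) K → RatFun n K) :=
  IsFractionRing.injective _ _

theorem toRat_thetaSum_univ (f : MvPolynomial (Fin n) K) :
    toRat (thetaSum Finset.univ f) = ∑ i, toRat (theta i f) := by
  simp [toRat, thetaSum_apply]

theorem toRat_smul (a : K) (f : MvPolynomial (Fin n) K) :
    toRat (a • f) = const n a * toRat f := by
  rw [const, IsScalarTower.algebraMap_apply K (MvPolynomial (Fin n) K) (RatFun n K), ← map_mul,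
    smul_eq_C_mul, algebraMap_eq]

theorem toRat_mulX_exchangeQuotient (i j : Fin n) (f : MvPolynomial (Fin n) K) :
    toRat (X i * exchangeQuotient i j f) = ratio K i j * (toRat f - toRat (exchange i j f)) := by
  rcases eq_or_ne i j with rfl | h
  · simp [exchangeQuotient, ratio_self]
  · have h₁ := var_sub_var_ne_zero (K := K) h
    have h₂ := congrArg (algebraMap (MvPolynomial (Fin n) K) (RatFun n K))
      (mul_exchangeQuotient h f)
    rw [map_mul, map_sub, map_sub] at h₂
    rw [ratio, toRat, map_mul, ← h₂]
    simp only [var] at h₁ ⊢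
    field_simp

theorem toRat_dunkl (β : K) (i : Fin n) (f : MvPolynomial (Fin n) K) :
    toRat (dunkl β i f) = toRat (theta i f) +
      const n β * ∑ j, ratio K i j * (toRat f - toRat (exchange i j f)) := by
  have h : dunkl β i f = theta i f +
      β • ∑ j ∈ Finset.univ.erase i, X i * exchangeQuotient i j f := by
    simp [dunkl, theta, mulX]
  rw [h, toRat, map_add]
  congr 1
  refine (toRat_smul _ _).trans ?_
  rw [toRat, map_sum, ← Finset.sum_erase Finset.univ (a := i) (by rw [ratio_self, zero_mul])]
  congr 1
  exact Finset.sum_congr rfl fun j _ => toRat_mulX_exchangeQuotient i j f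

theorem exchange_rename (σ : Equiv.Perm (Fin n)) (i j : Fin n) (f : MvPolynomial (Fin n) K) :
    exchange (σ i) (σ j) (rename σ f) = rename σ (exchange i j f) := by
  rw [exchange, exchange, rename_rename, rename_rename]
  congr 2
  funext k
  simp [Equiv.swap_apply_def, apply_ite σ]

theorem exchangeQuotient_rename (σ : Equiv.Perm (Fin n)) (i j : Fin n)
    (f : MvPolynomial (Fin n) K) :
    exchangeQuotient (σ i) (σ j) (rename σ f) = rename σ (exchangeQuotient i j f) := by
  rcases eq_or_ne i j with rfl | h
  · simp [exchangeQuotient]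
  · have h' : σ i ≠ σ j := fun e => h (σ.injective e)
    apply mul_left_cancel₀ (X_sub_X_ne_zero (K := K) h')
    rw [mul_exchangeQuotient h', exchange_rename, ← map_sub, ← mul_exchangeQuotient h, map_mul,
      map_sub, rename_X, rename_X]

theorem dunkl_rename (β : K) (σ : Equiv.Perm (Fin n)) (i : Fin n) (f : MvPolynomial (Fin n) K) :
    dunkl β (σ i) (rename σ f) = rename σ (dunkl β i f) := by
  have h : ∀ (i : Fin n) (f : MvPolynomial (Fin n) K), dunkl β i f = theta i f +
      β • ∑ j, X i * exchangeQuotient i j f := by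
    intro i f
    rw [← Finset.sum_erase Finset.univ (a := i) (by simp [exchangeQuotient])]
    simp [dunkl, theta, mulX]
  rw [h, h, map_add, theta_rename, map_smul, map_sum, ← Equiv.sum_comp σ]
  simp only [exchangeQuotient_rename, map_mul, rename_X]

theorem exchange_eq_self {f : MvPolynomial (Fin n) K} (hf : f.IsSymmetric) (i j : Fin n) :
    exchange i j f = f := hf _

theorem dunkl_of_isSymmetric (β : K) {f : MvPolynomial (Fin n) K} (hf : f.IsSymmetric)
    (i : Fin n) : dunkl β i f = theta i f := by
  apply toRat_injective
  simp [toRat_dunkl, exchange_eq_self hf]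

theorem exchange_dunkl_theta (β : K) {f : MvPolynomial (Fin n) K} (hf : f.IsSymmetric)
    (i j : Fin n) : exchange i j (dunkl β i (theta i f)) = dunkl β j (theta j f) := by
  rw [exchange, ← dunkl_rename, ← theta_rename, hf]
  simp

theorem dunklH_one_of_isSymmetric (β : K) {f : MvPolynomial (Fin n) K} (hf : f.IsSymmetric) :
    dunklH β 1 f = thetaSum Finset.univ f := by
  simp [dunklH, thetaSum, dunkl_of_isSymmetric β hf]

theorem toRat_dunkl_theta (β : K) {f : MvPolynomial (Fin n) K} (hf : f.IsSymmetric) (i : Fin n) :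
    toRat (dunkl β i (theta i f)) = toRat (theta i (theta i f)) +
      const n β * ∑ j, ratio K i j * (toRat (theta i f) - toRat (theta j f)) := by
  rw [toRat_dunkl]
  congr 2
  refine Finset.sum_congr rfl fun j _ => ?_
  rw [exchange, ← theta_rename, hf, Equiv.swap_apply_left]

theorem toRat_dunklH_two (β : K) {f : MvPolynomial (Fin n) K} (hf : f.IsSymmetric) :
    toRat (dunklH β 2 f) = ∑ i, toRat (theta i (theta i f)) +
      const n β * ∑ i, (2 * ratioSum K i - (n - 1)) * toRat (theta i f) := by
  rw [← sum_sum_ratio_mul_sub]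
  simp [dunklH, sq, dunkl_of_isSymmetric β hf, toRat_dunkl_theta β hf, Finset.sum_add_distrib,
    Finset.mul_sum]

/-- The action of `x_i ∂_i` on `d_i x_i ∂_i f`: the product rule for the quotients
`(x_i ∂_i f - x_j ∂_j f) x_i / (x_i - x_j)`, with denominators cleared. -/
theorem toRat_theta_dunkl_theta (β : K) {f : MvPolynomial (Fin n) K} (hf : f.IsSymmetric)
    (i : Fin n) :
    toRat (theta i (dunkl β i (theta i f))) = toRat (theta i (theta i (theta i f))) +
      const n β * ∑ j, ((ratio K i j - ratio K i j ^ 2) *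
        (toRat (theta i f) - toRat (theta j f)) +
        ratio K i j * (toRat (theta i (theta i f)) - toRat (theta i (theta j f)))) := by
  have h : dunkl β i (theta i f) = theta i (theta i f) +
      β • ∑ j ∈ Finset.univ.erase i, X i * exchangeQuotient i j (theta i f) := by
    simp [dunkl, theta, mulX]
  rw [h, map_add, map_smul, toRat, map_add]
  congr 1
  refine (toRat_smul _ _).trans ?_
  rw [map_sum, toRat, map_sum,
    ← Finset.sum_erase Finset.univ (a := i) (by rw [ratio_self]; ring)]
  congr 1
  refine Finset.sum_congr rfl fun j hj => ?_
  have hij : i ≠ j := (Finset.ne_of_mem_erase hj).symm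
  have h₀ := var_sub_var_ne_zero (K := K) hij
  have h₁ : (X i - X j) * (X i * exchangeQuotient i j (theta i f)) =
      X i * (theta i f - theta j f) := by
    rw [mul_left_comm, mul_exchangeQuotient hij, exchange, ← theta_rename, hf,
      Equiv.swap_apply_left]
  generalize X i * exchangeQuotient i j (theta i f) = p at h₁ ⊢
  have h₂ := congrArg (theta i) h₁
  rw [theta_mul, map_sub, theta_X_self, theta_X_of_ne hij, sub_zero, theta_mul, theta_X_self,
    map_sub] at h₂
  replace h₁ := congrArg (algebraMap (MvPolynomial (Fin n) K) (RatFun n K)) h₁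
  replace h₂ := congrArg (algebraMap (MvPolynomial (Fin n) K) (RatFun n K)) h₂
  rw [map_mul, map_mul, map_sub, map_sub] at h₁
  rw [map_add, map_add, map_mul, map_mul, map_mul, map_mul, map_sub, map_sub, map_sub] at h₂
  change (var K i - var K j) * _ = var K i * _ at h₁
  change var K i * _ + (var K i - var K j) * _ = var K i * _ + var K i * _ at h₂
  apply mul_left_cancel₀ h₀
  have h₃ : (var K i - var K j) * ratio K i j = var K i := by
    rw [ratio]
    field_simp
  have h₄ : algebraMap (MvPolynomial (Fin n) K) (RatFun n K) p =
        ratio K i j * (toRat (theta i f) - toRat (theta j f)) := by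
    apply mul_left_cancel₀ h₀
    rw [h₁, ← mul_assoc, h₃]
  rw [h₄] at h₂
  simp only [toRat] at h₂ ⊢
  linear_combination h₂ - ((1 - ratio K i j) * (algebraMap _ (RatFun n K) (theta i f) -
    algebraMap _ (RatFun n K) (theta j f)) + (algebraMap _ (RatFun n K) (theta i (theta i f)) -
    algebraMap _ (RatFun n K) (theta i (theta j f)))) * h₃

/-- `H_3` on symmetric polynomials as a differential operator. The mixed second derivatives only
enter through the square of the Euler operator, since `y_ij + y_ji = 1` for the ratios. -/
theorem toRat_dunklH_three [CharZero K] (β : K) {f : MvPolynomial (Fin n) K}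
    (hf : f.IsSymmetric) :
    toRat (dunklH β 3 f) = ∑ i, toRat (theta i (theta i (theta i f))) +
      const n β * (∑ i, (3 * ratioSum K i - (n - 1) + 1 / 2) * toRat (theta i (theta i f)) -
        1 / 2 * toRat (thetaSum Finset.univ (thetaSum Finset.univ f))) +
      const n β ^ 2 * ∑ i, (3 * ratioSum K i ^ 2 - 3 * ∑ j, ratio K i j ^ 2 -
        2 * (n - 1) * ratioSum K i + 4 * ratioSum K i - (n - 1)) * toRat (theta i f) := by
  -- The exchange `K_{i,j}` takes `d_i (d_i f)` to `d_j (d_j f)`, as `f` is symmetric.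
  have h₁ : toRat (dunklH β 3 f) = ∑ i, (toRat (theta i (dunkl β i (theta i f))) +
      const n β * ∑ j, ratio K i j *
        (toRat (dunkl β i (theta i f)) - toRat (dunkl β j (theta j f)))) := by
    simp [dunklH, pow_succ, dunkl_of_isSymmetric β hf, toRat_dunkl, exchange_dunkl_theta β hf]
  have h₂ : toRat (thetaSum Finset.univ (thetaSum Finset.univ f)) =
      ∑ i, ∑ j, toRat (theta i (theta j f)) := by
    simp only [thetaSum_apply, toRat, map_sum]
    exact Finset.sum_comm
  have h₃ := two_mul_sum_sum_ratio_mul_symm (fun i j => toRat (theta i (theta j f)))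
    fun i j => by rw [theta_comm]
  rw [h₁, Finset.sum_add_distrib, ← Finset.mul_sum, sum_sum_ratio_mul_sub]
  simp only [toRat_theta_dunkl_theta β hf, toRat_dunkl_theta β hf, mul_add,
    Finset.sum_add_distrib, ← Finset.mul_sum, sum_sum_ratio_sub_sq_mul_sub]
  have h₄ : ∑ i : Fin n, ∑ j, ratio K i j *
      (toRat (theta i (theta i f)) - toRat (theta i (theta j f))) =
      ∑ i, ratioSum K i * toRat (theta i (theta i f)) -
        ∑ i, ∑ j, ratio K i j * toRat (theta i (theta j f)) := by
    simp only [mul_sub, Finset.sum_sub_distrib, ratioSum, Finset.sum_mul]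
  have h₅ : ∑ i, (2 * ratioSum K i - ((n : RatFun n K) - 1)) * (const n β *
      ∑ j, ratio K i j * (toRat (theta i f) - toRat (theta j f))) =
      const n β * ∑ i, (2 * ratioSum K i - (n - 1)) *
        ∑ j, ratio K i j * (toRat (theta i f) - toRat (theta j f)) := by
    rw [Finset.mul_sum]
    exact Finset.sum_congr rfl fun i _ => by ring
  rw [h₄, h₅, sum_mul_sum_ratio_mul_sub, h₂]
  have h₆ : ∑ i, (3 * ratioSum K i - ((n : RatFun n K) - 1) + 1 / 2) *
      toRat (theta i (theta i f)) =
      ∑ i, (2 * ratioSum K i - ((n : RatFun n K) - 1)) * toRat (theta i (theta i f)) +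
        ∑ i, ratioSum K i * toRat (theta i (theta i f)) +
        1 / 2 * ∑ i, toRat (theta i (theta i f)) := by
    rw [Finset.mul_sum, ← Finset.sum_add_distrib, ← Finset.sum_add_distrib]
    exact Finset.sum_congr rfl fun i _ => by ring
  rw [h₆]
  linear_combination (-const n β / 2) * h₃

end Dunkl

/-! ### The third order of the Macdonald operators -/

section Macdonald

variable {n : ℕ} {K : Type*} [Field K] [CharZero K]

/-- The factor of the summand of index `I` of the Macdonald operator by which the shifted
polynomial is multiplied, with the power of `t` included. -/
noncomputable def weight (β : K) (I : Finset (Fin n)) : PowerSeries (RatFun n K) :=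
  scalar n (PowerSeries.rescale β (PowerSeries.exp K)) ^ (I.card * (I.card - 1) / 2) *
    ∏ i ∈ I, ∏ j ∈ Iᶜ,
      (scalar n (PowerSeries.rescale β (PowerSeries.exp K)) * PowerSeries.C (var K i) -
        PowerSeries.C (var K j)) * PowerSeries.C (var K i - var K j)⁻¹

/-- The summand of index `I` in the `m`-th order of the Macdonald operator. -/
noncomputable def orderTerm (β : K) (m : ℕ) (I : Finset (Fin n)) (f : MvPolynomial (Fin n) K) :
    RatFun n K :=
  PowerSeries.coeff m (weight β I * qShift (PowerSeries.exp K) I f)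

theorem macdonaldOrder_eq_sum (β : K) (m r : ℕ) (f : MvPolynomial (Fin n) K) :
    macdonaldOrder β m r f = ∑ I ∈ Finset.univ.powersetCard r, orderTerm β m I f := by
  rw [macdonaldOrder, macdonald, Finset.mul_sum, map_sum]
  refine Finset.sum_congr rfl fun I hI => ?_
  rw [orderTerm, weight, (Finset.mem_powersetCard_univ.mp hI), mul_assoc]

theorem cast_card_mul_card_sub_one_div_two (m : ℕ) :
    ((m * (m - 1) / 2 : ℕ) : RatFun n K) = m * (m - 1) / 2 := by
  rw [Nat.cast_div (Nat.even_mul_pred_self m).two_dvd (by norm_num)]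
  rcases m with _ | m <;> simp

/-- The power of `t` in the definition of the Macdonald operator makes the logarithm of the weight
additive over `I` at first order. -/
theorem hasLogCoeffs_weight (β : K) (I : Finset (Fin n)) :
    HasLogCoeffs (weight β I) (const n β * ∑ i ∈ I, ratioSum K i)
      (const n β ^ 2 / 2 * ∑ i ∈ I, ∑ j ∈ Iᶜ, (ratio K i j - ratio K i j ^ 2))
      (const n β ^ 3 / 6 * ∑ i ∈ I, ∑ j ∈ Iᶜ,
        (ratio K i j - 3 * ratio K i j ^ 2 + 2 * ratio K i j ^ 3)) := by
  have h := ((hasLogCoeffs_scalar_exp (n := n) β).pow (I.card * (I.card - 1) / 2)).mul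
    (HasLogCoeffs.prod I fun i hi => HasLogCoeffs.prod Iᶜ fun j hj =>
      hasLogCoeffs_weight_factor β (i := i) (j := j) (by
        rintro rfl
        exact Finset.mem_compl.mp hj hi))
  -- The pairs inside `I` contribute one half each, in all the exponent of `t`.
  have e : ∑ i ∈ I, ratioSum K i = ∑ i ∈ I, ∑ j ∈ Iᶜ, ratio K i j +
      ((I.card * (I.card - 1) / 2 : ℕ) : RatFun n K) := by
    rw [cast_card_mul_card_sub_one_div_two]
    have h' : ∑ i ∈ I, ratioSum K i =
        ∑ i ∈ I, ∑ j ∈ Iᶜ, ratio K i j + ∑ i ∈ I, ∑ j ∈ I, ratio K i j := by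
      rw [← Finset.sum_add_distrib]
      exact Finset.sum_congr rfl fun i _ => (Finset.sum_compl_add_sum I _).symm
    linear_combination h' + two_mul_sum_ratio (K := K) I / 2
  convert h using 1
  · rfl
  · rw [e]
    simp only [← Finset.mul_sum]
    ring
  · simp only [← Finset.mul_sum]
    ring
  · simp only [← Finset.mul_sum]
    ring

/-- The shift `x_i ↦ exp(h) x_i`, `i ∈ I`, is the exponential of `h ∑_{i ∈ I} x_i ∂_i`. -/
theorem coeff_qShift_exp (I : Finset (Fin n)) (f : MvPolynomial (Fin n) K) :
    PowerSeries.coeff 0 (qShift (PowerSeries.exp K) I f) = toRat f ∧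
    PowerSeries.coeff 1 (qShift (PowerSeries.exp K) I f) = toRat (thetaSum I f) ∧
    PowerSeries.coeff 2 (qShift (PowerSeries.exp K) I f) =
      toRat (thetaSum I (thetaSum I f)) / 2 ∧
    PowerSeries.coeff 3 (qShift (PowerSeries.exp K) I f) =
      toRat (thetaSum I (thetaSum I (thetaSum I f))) / 6 := by
  have hexp : PowerSeries.exp K = PowerSeries.rescale (1 : K) (PowerSeries.exp K) := by simp
  have hc : const n (1 : K) = 1 := map_one _
  induction f using MvPolynomial.induction_on with
  | C a =>
    have h : qShift (PowerSeries.exp K) I (C a : MvPolynomial (Fin n) K) =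
        PowerSeries.C (toRat (C a)) := by
      rw [qShift, algHom_C, toRat, ← algebraMap_eq,
        ← IsScalarTower.algebraMap_apply K (MvPolynomial (Fin n) K) (RatFun n K), PowerSeries.algebraMap_apply]
    rw [h]
    simp [thetaSum_C, PowerSeries.coeff_C]
  | add p q hp hq =>
    have h : qShift (PowerSeries.exp K) I (p + q) =
        qShift (PowerSeries.exp K) I p + qShift (PowerSeries.exp K) I q := map_add _ _ _
    simp only [h, map_add, hp, hq, toRat]
    refine ⟨trivial, trivial, ?_, ?_⟩ <;> ring
  | mul_X p j hp =>
    obtain ⟨h0, h1, h2, h3⟩ := hp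
    have h : qShift (PowerSeries.exp K) I (p * X j) = qShift (PowerSeries.exp K) I p *
        if j ∈ I then scalar n (PowerSeries.exp K) * PowerSeries.C (var K j)
          else PowerSeries.C (var K j) := by
      rw [qShift, map_mul, aeval_X]
      rfl
    have hx : toRat (X j : MvPolynomial (Fin n) K) = var K j := rfl
    rw [h, coeff_zero_mul_eq, coeff_one_mul_eq, coeff_two_mul_eq, coeff_three_mul_eq, h0, h1, h2,
      h3]
    simp only [thetaSum_mul, thetaSum_X, map_add, map_mul, toRat] at hx ⊢
    split_ifs with hj
    · rw [hexp]
      simp only [PowerSeries.coeff_mul_C, coeff_scalar_exp, hc, thetaSum_X, if_pos hj, hx]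
      refine ⟨?_, ?_, ?_, ?_⟩ <;> simp [Nat.factorial] <;> field_simp <;> ring
    · simp [PowerSeries.coeff_C, hx]
      refine ⟨?_, ?_⟩ <;> ring

section OrderTerm

variable (β : K) (I : Finset (Fin n)) (f : MvPolynomial (Fin n) K) {b₁ b₂ b₃ : RatFun n K}

theorem orderTerm_zero : orderTerm β 0 I f = toRat f := by
  rw [orderTerm, coeff_zero_mul_eq, (hasLogCoeffs_weight β I).coeff_zero,
    (coeff_qShift_exp I f).1, one_mul]

theorem orderTerm_one (h : HasLogCoeffs (weight β I) b₁ b₂ b₃) :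
    orderTerm β 1 I f = b₁ * toRat f + toRat (thetaSum I f) := by
  obtain ⟨h0, h1, -, -⟩ := coeff_qShift_exp I f
  rw [orderTerm, coeff_one_mul_eq, h.coeff_zero, h.coeff_one, h0, h1]
  ring

theorem orderTerm_two (h : HasLogCoeffs (weight β I) b₁ b₂ b₃) :
    orderTerm β 2 I f = (b₁ ^ 2 / 2 + b₂) * toRat f + b₁ * toRat (thetaSum I f) +
      toRat (thetaSum I (thetaSum I f)) / 2 := by
  obtain ⟨h0, h1, h2, -⟩ := coeff_qShift_exp I f
  rw [orderTerm, coeff_two_mul_eq, h.coeff_zero, h.coeff_one, h.coeff_two, h0, h1, h2]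
  ring

theorem orderTerm_three (h : HasLogCoeffs (weight β I) b₁ b₂ b₃) :
    orderTerm β 3 I f = (b₁ ^ 3 / 6 + b₁ * b₂ + b₃) * toRat f +
      (b₁ ^ 2 / 2 + b₂) * toRat (thetaSum I f) +
      b₁ * (toRat (thetaSum I (thetaSum I f)) / 2) +
      toRat (thetaSum I (thetaSum I (thetaSum I f))) / 6 := by
  obtain ⟨h0, h1, h2, h3⟩ := coeff_qShift_exp I f
  rw [orderTerm, coeff_three_mul_eq, h.coeff_zero, h.coeff_one, h.coeff_two, h.coeff_three, h0,
    h1, h2, h3]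
  ring

end OrderTerm

/-- Each summand of the third order has degree at most `3` in the indicator variables of `I`: the
`m`-th order of the logarithm of the weight has degree at most `m`. -/
theorem orderTerm_three_mem_subsetPoly (β : K) (f : MvPolynomial (Fin n) K) :
    (fun I => orderTerm β 3 I f) ∈ subsetPoly (Fin n) (RatFun n K) 3 := by
  have hf₁ : (fun I => toRat (thetaSum I f)) ∈ subsetPoly (Fin n) (RatFun n K) 1 := by
    simpa only [thetaSum_apply, toRat, map_sum] using sum_mem_subsetPoly _
  have hf₂ : (fun I => toRat (thetaSum I (thetaSum I f))) ∈
      subsetPoly (Fin n) (RatFun n K) 2 := by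
    simpa only [thetaSum_apply, toRat, map_sum] using sum_sum_mem_subsetPoly _
  have hf₃ : (fun I => toRat (thetaSum I (thetaSum I (thetaSum I f)))) ∈
      subsetPoly (Fin n) (RatFun n K) 3 := by
    simpa only [thetaSum_apply, toRat, map_sum] using sum_sum_sum_mem_subsetPoly _
  have h := exp_order_three_mem_subsetPoly (toRat f)
    (smul_mem_subsetPoly (const n β) (sum_mem_subsetPoly (ratioSum K)))
    (smul_mem_subsetPoly (const n β ^ 2 / 2) (sum_sum_compl_mem_subsetPoly
      fun i j => ratio K i j - ratio K i j ^ 2))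
    (smul_mem_subsetPoly (const n β ^ 3 / 6) (sum_sum_compl_mem_subsetPoly
      fun i j => ratio K i j - 3 * ratio K i j ^ 2 + 2 * ratio K i j ^ 3)) hf₁ hf₂ hf₃
  simpa only [← orderTerm_three β _ f (hasLogCoeffs_weight β _)] using h

end Macdonald

/-! ### The sums over sets of one element, `n - 1` elements and `n` elements -/

section SpecialSizes

variable {n : ℕ} {K : Type*} [Field K] [CharZero K]

/-- The Macdonald operator for `r = 1`, applied to `1`. -/
theorem sum_weight_singleton (β : K) :
    ∑ i : Fin n, weight β {i} = ∑ k ∈ Finset.range n,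
      scalar n (PowerSeries.rescale β (PowerSeries.exp K)) ^ k := by
  rw [← sum_prod_one_add_mul_ratio (K := K)]
  refine Finset.sum_congr rfl fun i _ => ?_
  simp only [weight, Finset.card_singleton, Nat.sub_self, mul_zero, Nat.zero_div, pow_zero,
    one_mul, Finset.prod_singleton]
  refine Finset.prod_congr rfl fun j hj => ?_
  rw [weight_factor_eq _ fun h => by simp [h] at hj]
  rfl

theorem sum_range_cast_sq (n : ℕ) : ∑ k ∈ Finset.range n, ((k : K) ^ 2) =
    n * (n - 1) * (2 * n - 1) / 6 := by
  induction n with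
  | zero => simp
  | succ m ih =>
    rw [Finset.sum_range_succ, ih]
    push_cast
    field_simp
    ring

theorem sum_range_cast_cube (n : ℕ) : ∑ k ∈ Finset.range n, ((k : K) ^ 3) =
    n ^ 2 * (n - 1) ^ 2 / 4 := by
  induction n with
  | zero => simp
  | succ m ih =>
    rw [Finset.sum_range_succ, ih]
    push_cast
    field_simp
    ring

theorem sum_coeff_two_weight_singleton (β : K) :
    ∑ i : Fin n, PowerSeries.coeff 2 (weight β {i}) =
      const n β ^ 2 * (n * (n - 1) * (2 * n - 1) / 12) := by
  rw [← map_sum, sum_weight_singleton, map_sum]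
  simp only [((hasLogCoeffs_scalar_exp (n := n) β).pow _).coeff_two, mul_zero, add_zero, mul_pow,
    ← Finset.sum_div, ← Finset.sum_mul, sum_range_cast_sq]
  ring

theorem sum_coeff_three_weight_singleton (β : K) :
    ∑ i : Fin n, PowerSeries.coeff 3 (weight β {i}) =
      const n β ^ 3 * (n ^ 2 * (n - 1) ^ 2 / 24) := by
  rw [← map_sum, sum_weight_singleton, map_sum]
  simp only [((hasLogCoeffs_scalar_exp (n := n) β).pow _).coeff_three, mul_zero, add_zero, mul_pow,
    ← Finset.sum_div, ← Finset.sum_mul, sum_range_cast_cube]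
  ring

theorem sum_ratioSum : ∑ i : Fin n, ratioSum K i = n * (n - 1) / 2 := by
  have h := two_mul_sum_ratio (K := K) (Finset.univ : Finset (Fin n))
  rw [Finset.card_univ, Fintype.card_fin] at h
  simp only [ratioSum]
  linear_combination h / 2

theorem sum_compl_singleton_of_eq_zero {ι M : Type*} [Fintype ι] [DecidableEq ι]
    [AddCommMonoid M] (u : ι → M) {i : ι} (hu : u i = 0) : ∑ j ∈ {i}ᶜ, u j = ∑ j, u j := by
  rw [← Finset.sum_compl_add_sum {i}, Finset.sum_singleton, hu, add_zero]

theorem hasLogCoeffs_weight_singleton (β : K) (i : Fin n) :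
    HasLogCoeffs (weight β {i}) (const n β * ratioSum K i)
      (const n β ^ 2 / 2 * (ratioSum K i - ∑ j, ratio K i j ^ 2))
      (const n β ^ 3 / 6 * ∑ j, (ratio K i j - 3 * ratio K i j ^ 2 + 2 * ratio K i j ^ 3)) := by
  have h := hasLogCoeffs_weight β {i}
  simp only [Finset.sum_singleton] at h
  rw [sum_compl_singleton_of_eq_zero (fun j => ratio K i j - ratio K i j ^ 2)
      (by simp [ratio_self]),
    sum_compl_singleton_of_eq_zero
      (fun j => ratio K i j - 3 * ratio K i j ^ 2 + 2 * ratio K i j ^ 3) (by simp [ratio_self]),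
    Finset.sum_sub_distrib] at h
  exact h

/-- Passing from `{i}` to its complement replaces `h` by `-h` in the logarithm of the weight,
up to a first-order term independent of `i`. -/
theorem hasLogCoeffs_weight_compl_singleton (β : K) (i : Fin n) :
    HasLogCoeffs (weight β {i}ᶜ) (const n β * (n * (n - 1) / 2) - const n β * ratioSum K i)
      (const n β ^ 2 / 2 * (ratioSum K i - ∑ j, ratio K i j ^ 2))
      (-(const n β ^ 3 / 6 *
        ∑ j, (ratio K i j - 3 * ratio K i j ^ 2 + 2 * ratio K i j ^ 3))) := by
  have h := hasLogCoeffs_weight β {i}ᶜ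
  simp only [compl_compl, Finset.sum_singleton] at h
  simp only [ratio_sub_sq_comm _ i, ratio_cubic_antisymm _ i, Finset.sum_neg_distrib] at h
  rw [sum_compl_singleton_of_eq_zero (fun j => ratio K i j - ratio K i j ^ 2)
      (by simp [ratio_self]),
    sum_compl_singleton_of_eq_zero
      (fun j => ratio K i j - 3 * ratio K i j ^ 2 + 2 * ratio K i j ^ 3) (by simp [ratio_self]),
    Finset.sum_sub_distrib, mul_neg] at h
  have h₁ := Finset.sum_compl_add_sum {i} (ratioSum K (n := n))
  rw [sum_ratioSum, Finset.sum_singleton] at h₁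
  rw [eq_sub_of_add_eq h₁, mul_sub] at h
  exact h

theorem hasLogCoeffs_weight_univ (β : K) :
    HasLogCoeffs (weight β (Finset.univ : Finset (Fin n))) (const n β * (n * (n - 1) / 2)) 0 0 := by
  have h := hasLogCoeffs_weight β (Finset.univ : Finset (Fin n))
  simpa [sum_ratioSum] using h

variable (β : K) {f : MvPolynomial (Fin n) K}

theorem sum_orderTerm_zero_singleton (f : MvPolynomial (Fin n) K) :
    ∑ i, orderTerm β 0 {i} f = n * toRat f := by
  simp [orderTerm_zero]

theorem sum_orderTerm_one_singleton (f : MvPolynomial (Fin n) K) :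
    ∑ i, orderTerm β 1 {i} f =
      const n β * (n * (n - 1) / 2) * toRat f + toRat (thetaSum Finset.univ f) := by
  simp only [orderTerm_one β _ f (hasLogCoeffs_weight_singleton β _), thetaSum_singleton,
    Finset.sum_add_distrib, ← Finset.sum_mul, ← Finset.mul_sum, sum_ratioSum, toRat_thetaSum_univ]

theorem sum_orderTerm_two_singleton (hf : f.IsSymmetric) :
    ∑ i, orderTerm β 2 {i} f = 1 / 2 * toRat (dunklH β 2 f) +
      const n β * ((n - 1) / 2) * toRat (thetaSum Finset.univ f) +
      const n β ^ 2 * (n * (n - 1) * (2 * n - 1) / 12) * toRat f := by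
  have h := sum_coeff_two_weight_singleton (n := n) β
  simp only [(hasLogCoeffs_weight_singleton β _).coeff_two] at h
  rw [toRat_dunklH_two β hf, ← h, toRat_thetaSum_univ]
  simp only [orderTerm_two β _ f (hasLogCoeffs_weight_singleton β _), thetaSum_singleton,
    Finset.mul_sum, Finset.sum_mul, ← Finset.sum_add_distrib, mul_add]
  exact Finset.sum_congr rfl fun i _ => by ring

theorem sum_orderTerm_three_singleton (hf : f.IsSymmetric) :
    ∑ i, orderTerm β 3 {i} f = 1 / 6 * toRat (dunklH β 3 f) +
      const n β * ((2 * n - 3) / 12) * toRat (dunklH β 2 f) +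
      const n β * (1 / 12) * toRat (thetaSum Finset.univ (thetaSum Finset.univ f)) +
      const n β ^ 2 * ((n - 1) * (2 * n - 1) / 12) * toRat (thetaSum Finset.univ f) +
      const n β ^ 3 * (n ^ 2 * (n - 1) ^ 2 / 24) * toRat f := by
  have h := sum_coeff_three_weight_singleton (n := n) β
  simp only [(hasLogCoeffs_weight_singleton β _).coeff_three] at h
  rw [toRat_dunklH_three β hf, toRat_dunklH_two β hf, ← h]
  generalize toRat (thetaSum Finset.univ (thetaSum Finset.univ f)) = e
  have e' : ∀ s : RatFun n K, 1 / 6 * (∑ i, toRat (theta i (theta i (theta i f))) +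
      const n β * (s - 1 / 2 * e)) = 1 / 6 * ∑ i, toRat (theta i (theta i (theta i f))) +
      const n β / 6 * s - const n β * (1 / 12) * e := fun s => by ring
  rw [mul_add (1 / 6 : RatFun n K), e', toRat_thetaSum_univ]
  rw [show ∀ a b c d g k l : RatFun n K, a + b - c + d + g + c + k + l = a + b + d + g + k + l
    from fun a b c d g k l => by ring]
  simp only [orderTerm_three β _ f (hasLogCoeffs_weight_singleton β _), thetaSum_singleton,
    Finset.mul_sum, Finset.sum_mul, ← Finset.sum_add_distrib, mul_add]
  refine Finset.sum_congr rfl fun i _ => ?_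
  simp only [← Finset.mul_sum]
  ring

theorem orderTerm_three_univ (f : MvPolynomial (Fin n) K) :
    orderTerm β 3 Finset.univ f =
      (const n β * (n * (n - 1) / 2)) ^ 3 / 6 * toRat f +
      (const n β * (n * (n - 1) / 2)) ^ 2 / 2 * toRat (thetaSum Finset.univ f) +
      const n β * (n * (n - 1) / 2) / 2 *
        toRat (thetaSum Finset.univ (thetaSum Finset.univ f)) +
      toRat (thetaSum Finset.univ (thetaSum Finset.univ (thetaSum Finset.univ f))) / 6 := by
  rw [orderTerm_three β _ f (hasLogCoeffs_weight_univ β)]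
  ring

/-- The summand of index `{i}ᶜ` is the summand of index `{i}` for `q⁻¹` and `t⁻¹`, composed with
`exp (h (N + E))`, where `E` is the Euler operator and `N = β n (n - 1) / 2`. -/
theorem orderTerm_three_compl_singleton (i : Fin n) (f : MvPolynomial (Fin n) K)
    {N : RatFun n K} (hN : N = const n β * (n * (n - 1) / 2)) {f₁ f₂ f₃ : MvPolynomial (Fin n) K}
    (h₁ : f₁ = thetaSum Finset.univ f) (h₂ : f₂ = thetaSum Finset.univ f₁)
    (h₃ : f₃ = thetaSum Finset.univ f₂) :
    orderTerm β 3 {i}ᶜ f =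
      (N ^ 3 * orderTerm β 0 {i} f + 3 * N ^ 2 * orderTerm β 0 {i} f₁ +
        3 * N * orderTerm β 0 {i} f₂ + orderTerm β 0 {i} f₃) / 6 -
      (N ^ 2 * orderTerm β 1 {i} f + 2 * N * orderTerm β 1 {i} f₁ +
        orderTerm β 1 {i} f₂) / 2 +
      (N * orderTerm β 2 {i} f + orderTerm β 2 {i} f₁) - orderTerm β 3 {i} f := by
  rw [orderTerm_three β _ f (hasLogCoeffs_weight_compl_singleton β i)]
  simp only [orderTerm_three β _ _ (hasLogCoeffs_weight_singleton β i),
    orderTerm_two β _ _ (hasLogCoeffs_weight_singleton β i),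
    orderTerm_one β _ _ (hasLogCoeffs_weight_singleton β i), orderTerm_zero, ← hN,
    thetaSum_singleton, thetaSum_compl_singleton, map_sub, ← h₁, ← h₂, ← h₃, toRat,
    ← theta_thetaSum]
  ring

end SpecialSizes

/-! ### Binomial coefficients with an integral lower index -/

section Binomial

theorem binom_of_neg (a : ℕ) {b : ℤ} (hb : b < 0) : binom a b = 0 := by
  simp [binom, not_le.mpr hb]

theorem binom_succ (a : ℕ) (b : ℤ) : binom (a + 1) b = binom a b + binom a (b - 1) := by
  rcases lt_trichotomy b 0 with hb | rfl | hb
  · rw [binom_of_neg _ hb, binom_of_neg _ hb, binom_of_neg _ (by omega), add_zero]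
  · simp [binom]
  · obtain ⟨k, rfl⟩ : ∃ k : ℕ, b = (k + 1 : ℕ) := ⟨(b - 1).toNat, by omega⟩
    have e : ((k + 1 : ℕ) : ℤ) - 1 = (k : ℕ) := by push_cast; ring
    rw [e, binom_of_nat, binom_of_nat, binom_of_nat, Nat.choose_succ_succ]
    push_cast
    ring

theorem binom_mul_self (a : ℕ) (b : ℤ) : binom a b * b = binom a (b - 1) * (a - b + 1) := by
  rcases lt_trichotomy b 0 with hb | rfl | hb
  · rw [binom_of_neg _ hb, binom_of_neg _ (by omega), zero_mul, zero_mul]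
  · simp [binom]
  · obtain ⟨k, rfl⟩ : ∃ k : ℕ, b = (k + 1 : ℕ) := ⟨(b - 1).toNat, by omega⟩
    have e : ((k + 1 : ℕ) : ℤ) - 1 = (k : ℕ) := by push_cast; ring
    rw [e, binom_of_nat, binom_of_nat]
    rcases le_or_gt k a with h | h
    · have := Nat.choose_succ_right_eq a k
      have h' : ((a.choose (k + 1) * (k + 1) : ℕ) : ℚ) = ((a.choose k * (a - k) : ℕ) : ℚ) :=
        congrArg _ this
      push_cast [Nat.cast_sub h] at h' ⊢
      linear_combination h'
    · rw [Nat.choose_eq_zero_of_lt h, Nat.choose_eq_zero_of_lt (by omega)]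
      simp

theorem cast_ite_choose_eq_binom (n r m : ℕ) :
    ((if m ≤ r then (n - m).choose (r - m) else 0 : ℕ) : ℚ) = binom (n - m) ((r : ℤ) - m) := by
  split_ifs with h
  · rw [← Nat.cast_sub h, binom_of_nat]
  · rw [binom_of_neg _ (by omega), Nat.cast_zero]

/-- The binomial coefficients in the formula are polynomials in `n` and `r`, up to a common factor.
This also holds at the boundary values of `r`, where some of them vanish. -/
theorem exists_binom_eq_mul (n r : ℕ) (hn : 3 ≤ n) : ∃ c : ℚ,
    binom (n - 3) ((r : ℤ) - 1) = (n - r) * (n - r - 1) * c ∧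
    binom (n - 3) ((r : ℤ) - 2) = (r - 1) * (n - r) * c ∧
    binom (n - 3) ((r : ℤ) - 3) = (r - 1) * (r - 2) * c ∧
    binom (n - 2) ((r : ℤ) - 1) = (n - 2) * (n - r) * c ∧
    binom (n - 2) ((r : ℤ) - 2) = (n - 2) * (r - 1) * c ∧
    binom (n - 1) ((r : ℤ) - 1) = (n - 1) * (n - 2) * c ∧
    r * binom n r = n * (n - 1) * (n - 2) * c := by
  obtain ⟨p, rfl⟩ := Nat.exists_eq_add_of_le' hn
  have e₁ : p + 3 - 1 = p + 1 + 1 := by omega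
  have e₂ : p + 3 - 2 = p + 1 := by omega
  have e₃ : p + 3 - 3 = p := by omega
  have i₂ : (r : ℤ) - 1 - 1 = r - 2 := by ring
  have i₃ : (r : ℤ) - 2 - 1 = r - 3 := by ring
  have k₁ := binom_mul_self p ((r : ℤ) - 1)
  have k₂ := binom_mul_self p ((r : ℤ) - 2)
  have k₃ := binom_mul_self (p + 1 + 1) r
  have k₄ := binom_succ (p + 1 + 1) r
  rw [binom_succ (p + 1) ((r : ℤ) - 1), i₂, binom_succ p ((r : ℤ) - 1), i₂,
    binom_succ p ((r : ℤ) - 2), i₃] at k₃ k₄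
  rw [i₂] at k₁
  rw [i₃] at k₂
  rw [e₁, e₂, e₃, binom_succ (p + 1) ((r : ℤ) - 1), i₂, binom_succ p ((r : ℤ) - 1), i₂,
    binom_succ p ((r : ℤ) - 2), i₃]
  generalize binom p ((r : ℤ) - 1) = A at *
  generalize binom p ((r : ℤ) - 2) = B at *
  generalize binom p ((r : ℤ) - 3) = D at *
  generalize binom (p + 1 + 1) r = E at *
  have k₄' : binom (p + 3) r = E + (A + B + (B + D)) := k₄
  rw [k₄']
  push_cast at *
  have h₁ : (p : ℚ) + 1 ≠ 0 := by positivity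
  have h₂ : (p : ℚ) + 2 ≠ 0 := by positivity
  have h₁' : (p : ℚ) + 3 - 2 ≠ 0 := by convert h₁ using 1; ring
  have h₂' : (p : ℚ) + 3 - 1 ≠ 0 := by convert h₂ using 1; ring
  obtain ⟨c, hc⟩ : ∃ c : ℚ, A + B + (B + D) = (p + 3 - 1) * (p + 3 - 2) * c :=
    ⟨(A + B + (B + D)) / ((p + 3 - 1) * (p + 3 - 2)), by field_simp⟩
  have hd : ((p : ℚ) + 3 - 1) * (p + 3 - 2) ≠ 0 := mul_ne_zero h₂' h₁'
  have hA : A = (p + 3 - r) * (p + 3 - r - 1) * c := by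
    apply mul_left_cancel₀ hd
    linear_combination (p + 3 - r : ℚ) * (p + 3 - r - 1) * hc + (2 * (p + 3) - r - 2 : ℚ) * k₁ +
      (p + 3 - r - 1 : ℚ) * k₂
  have hB : B = (r - 1) * (p + 3 - r) * c := by
    apply mul_left_cancel₀ hd
    linear_combination (r - 1 : ℚ) * (p + 3 - r) * hc - (p + 3 - r : ℚ) * k₁ +
      (r - 1 : ℚ) * k₂
  have hD : D = (r - 1) * (r - 2) * c := by linear_combination hc - hA - 2 * hB
  refine ⟨c, hA, hB, hD, ?_, ?_, hc, ?_⟩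
  · linear_combination hA + hB
  · linear_combination hB + hD
  · linear_combination k₃ + (p + 3 : ℚ) * hc

end Binomial

/-! ### The formula for the third order -/

section Formula

variable {n : ℕ} {K : Type*} [Field K] (β : K) {f : MvPolynomial (Fin n) K}

theorem const_ratCast [CharZero K] (q : ℚ) : const n (q : K) = q := map_ratCast _ q

/-- The third order for any `r` for which the sum over the `r`-element sets is the combination, with
coefficients `a`, `b`, `c`, of the sums over the sets of size `1`, `n - 1` and `n`. -/
theorem macdonaldOrder_three_eq [CharZero K] (hf : f.IsSymmetric) {r : ℕ} {a b c : ℚ}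
    (hcount : ∀ m : ℕ, 1 ≤ m → m ≤ 3 → m ≤ n →
      binom (n - m) ((r : ℤ) - m) = a * (if m = 1 then 1 else 0) + b * (n - m) + c)
    {c₃ c₂₁ c₂ c₁₁₁ c₁₁ c₁ c₀ : ℚ} (h₃ : c₃ = (a - b) / 6) (h₂₁ : c₂₁ = b / 2)
    (h₂ : c₂ = (a - b) * (2 * n - 3) / 12 + b * (n * (n - 1)) / 4)
    (h₁₁₁ : c₁₁₁ = (b * (n - 3) + c) / 6)
    (h₁₁ : c₁₁ = (a - b) / 12 + b * (n - 1) / 2 + (b * (n - 3) + c) * (n * (n - 1)) / 4)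
    (h₁ : c₁ = (a - b) * ((n - 1) * (2 * n - 1)) / 12 +
      b * (n * (n - 1) ^ 2 / 4 + n * (n - 1) * (2 * n - 1) / 12) +
      (b * (n - 3) + c) * (n * (n - 1)) ^ 2 / 8)
    (h₀ : c₀ = (a - b) * (n * (n - 1)) ^ 2 / 24 +
      b * (n * (n - 1)) ^ 2 * (2 * n - 1) / 24 + (b * (n - 3) + c) * (n * (n - 1)) ^ 3 / 48) :
    macdonaldOrder β 3 r f = toRat
      (((c₃ : K) • dunklH β 3 + (c₂₁ : K) • (dunklH β 2 * dunklH β 1) +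
        (c₂ * β : K) • dunklH β 2 + (c₁₁₁ : K) • dunklH β 1 ^ 3 +
        (c₁₁ * β : K) • dunklH β 1 ^ 2 + (c₁ * β ^ 2 : K) • dunklH β 1 +
        (c₀ * β ^ 3 : K) • 1 : Module.End K (MvPolynomial (Fin n) K)) f) := by
  have hcount' : ∀ m : ℕ, 1 ≤ m → m ≤ 3 → m ≤ Fintype.card (Fin n) →
      ((if m ≤ r then (Fintype.card (Fin n) - m).choose (r - m) else 0 : ℕ) : RatFun n K) =
        a * (if m = 1 then 1 else 0) + b * (Fintype.card (Fin n) - m) + c := by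
    intro m hm hm' hmn
    rw [Fintype.card_fin] at hmn ⊢
    have h := congrArg (Rat.cast : ℚ → RatFun n K) (hcount m hm hm' hmn)
    rw [← cast_ite_choose_eq_binom, Rat.cast_natCast] at h
    rw [h]
    push_cast
    split_ifs <;> simp
  have hf' := thetaSum_univ_isSymmetric hf
  have hf'' := thetaSum_univ_isSymmetric hf'
  rw [macdonaldOrder_eq_sum,
    sum_powersetCard_eq (orderTerm_three_mem_subsetPoly β f) hcount',
    Finset.sum_congr rfl fun i _ => orderTerm_three_compl_singleton β i f rfl rfl rfl rfl,
    orderTerm_three_univ]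
  simp only [Finset.sum_add_distrib, Finset.sum_sub_distrib, ← Finset.mul_sum, ← Finset.sum_div,
    sum_orderTerm_three_singleton β hf, sum_orderTerm_two_singleton β hf,
    sum_orderTerm_two_singleton β hf', sum_orderTerm_one_singleton,
    sum_orderTerm_zero_singleton]
  simp only [LinearMap.add_apply, LinearMap.smul_apply, Module.End.mul_apply, pow_succ, pow_zero,
    one_mul, Module.End.one_apply, dunklH_one_of_isSymmetric β hf,
    dunklH_one_of_isSymmetric β hf', dunklH_one_of_isSymmetric β hf'']
  have hadd : ∀ g g' : MvPolynomial (Fin n) K, toRat (g + g') = toRat g + toRat g' :=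
    fun _ _ => map_add _ _ _
  have hconst : ∀ x y : K, const n (x * y) = const n x * const n y := fun _ _ => map_mul _ _ _
  simp only [hadd, toRat_smul, hconst, const_ratCast, h₃, h₂₁, h₂, h₁₁₁, h₁₁, h₁, h₀]
  push_cast
  ring

end Formula

end DunklMacdonald

open DunklMacdonald
theorem mainTheorem1 {K : Type*} [Field K] [CharZero K] (β : K) (n r : ℕ)
    (hr : 1 ≤ r) (hrn : r ≤ n)
    (f : MvPolynomial (Fin n) K) (hf : f.IsSymmetric) :
    (3 ≤ n →
      macdonaldOrder β 3 r f = algebraMap (MvPolynomial (Fin n) K) (RatFun n K)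
        (((coeffH3 n r : K) • dunklH β 3
          + ((1 / 2 * binom (n - 3) (r - 2) : ℚ) : K) • (dunklH β 2 * dunklH β 1)
          + ((((n : ℚ) ^ 2 * (3 * r - 1) - 7 * r * n + 6 * r) / (12 * (n - 2))
              * binom (n - 2) (r - 1) : ℚ) * β : K) • dunklH β 2
          + ((1 / 6 * binom (n - 3) (r - 3) : ℚ) : K) • dunklH β 1 ^ 3
          + (coeffH1Sq n r * β : K) • dunklH β 1 ^ 2
          + (((r : ℚ) / 24 * ((3 * r + 1) * n ^ 2 + (1 - 7 * r) * n + 2 * r)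
              * binom (n - 1) (r - 1) : ℚ) * β ^ 2 : K) • dunklH β 1
          + ((binom n r * ((r : ℚ) ^ 2 * n * (n - 1) / 48)
              * ((r + 1) * n + 1 - 3 * r) : ℚ) * β ^ 3 : K) • 1 :
            Module.End K (MvPolynomial (Fin n) K)) f)) ∧
    (r = 1 →
      macdonaldOrder β 3 r f = algebraMap (MvPolynomial (Fin n) K) (RatFun n K)
        (((1 / 6 : K) • dunklH β 3
          + ((2 * n - 3) / 12 * β : K) • dunklH β 2
          + (1 / 12 * β : K) • dunklH β 1 ^ 2
          + ((n - 1) * (2 * n - 1) / 12 * β ^ 2 : K) • dunklH β 1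
          + (n ^ 2 * (n - 1) ^ 2 / 24 * β ^ 3 : K) • 1 :
            Module.End K (MvPolynomial (Fin n) K)) f)) ∧
    (r = 2 →
      macdonaldOrder β 3 r f = algebraMap (MvPolynomial (Fin n) K) (RatFun n K)
        ((((n - 4) / 6 : K) • dunklH β 3
          + (1 / 2 : K) • (dunklH β 2 * dunklH β 1)
          + ((5 * n ^ 2 - 14 * n + 12) / 12 * β : K) • dunklH β 2
          + ((7 * n - 10) / 12 * β : K) • dunklH β 1 ^ 2
          + ((n - 1) * (7 * n ^ 2 - 13 * n + 4) / 12 * β ^ 2 : K) • dunklH β 1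
          + (n ^ 2 * (n - 1) ^ 2 * (3 * n - 5) / 24 * β ^ 3 : K) • 1 :
            Module.End K (MvPolynomial (Fin n) K)) f)) := by
  refine ⟨fun hn => ?_, ?_, ?_⟩
  · obtain ⟨c, hA, hB, hD, hA₂, hB₂, hC, hE⟩ := exists_binom_eq_mul n r hn
    have hn₁ : (n : ℚ) - 1 ≠ 0 := by
      have : (3 : ℚ) ≤ n := by exact_mod_cast hn
      linarith
    have hn₂ : (n : ℚ) - 2 ≠ 0 := by
      have : (3 : ℚ) ≤ n := by exact_mod_cast hn
      linarith
    have hc₃ : coeffH3 n r = (binom (n - 3) ((r : ℤ) - 1) - binom (n - 3) ((r : ℤ) - 2)) / 6 := by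
      rw [coeffH3]
      split_ifs with h
      · simp [h, binom]
      · have hr₁ : (r : ℚ) - 1 ≠ 0 := sub_ne_zero.mpr (by exact_mod_cast h)
        rw [hA, hB]
        field_simp
        ring
    -- The weights for the sizes `1`, `n - 1`, `n`, from Pascal's rule applied to
    -- `binom (n - m) (r - m)` for `m = 3, 2, 1` in this order.
    refine macdonaldOrder_three_eq β hf (a := binom (n - 3) ((r : ℤ) - 1))
      (b := binom (n - 3) ((r : ℤ) - 2))
      (c := binom (n - 3) ((r : ℤ) - 3) - (n - 3) * binom (n - 3) ((r : ℤ) - 2))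
      ?_ hc₃ ?_ ?_ ?_ ?_ ?_ ?_
    · intro m hm hm' _
      interval_cases m
      · simp only [Nat.cast_one, if_true]
        rw [hA, hB, hD, hC]
        ring
      · simp only [Nat.cast_ofNat]
        rw [hA, hB, hD, hB₂]
        norm_num
        ring
      · simp only [Nat.cast_ofNat]
        norm_num
        ring
    · ring
    · rw [hA₂, hA, hB]
      field_simp
      ring
    · ring
    · rw [coeffH1Sq, hC, hA, hB, hD]
      field_simp
      ring
    · rw [hC, hA, hB, hD]
      ring
    · rw [hA, hB, hD]
      linear_combination (r * n * (n - 1) / 48 * ((r + 1) * n + 1 - 3 * r) : ℚ) * hE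
  · rintro rfl
    have h := macdonaldOrder_three_eq β hf (r := 1) (a := 1) (b := 0) (c := 0) (c₃ := 1 / 6)
      (c₂₁ := 0) (c₂ := (2 * n - 3) / 12) (c₁₁₁ := 0) (c₁₁ := 1 / 12)
      (c₁ := (n - 1) * (2 * n - 1) / 12) (c₀ := n ^ 2 * (n - 1) ^ 2 / 24)
      (fun m hm _ _ => by
        rcases hm.eq_or_lt with rfl | hm
        · simp [binom]
        · rw [binom_of_neg _ (by omega), if_neg (by omega)]
          ring)
      (by ring) (by ring) (by ring) (by ring) (by ring) (by ring) (by ring)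
    rw [h, toRat]
    push_cast
    simp only [zero_smul, add_zero]
  · rintro rfl
    -- With these weights the case `m = 3` of the comparison also holds for `n ≥ 3`, and it does not
    -- occur for `n = 2`.
    have h := macdonaldOrder_three_eq β hf (r := 2) (a := n - 3) (b := 1) (c := 3 - n)
      (c₃ := (n - 4) / 6) (c₂₁ := 1 / 2) (c₂ := (5 * n ^ 2 - 14 * n + 12) / 12) (c₁₁₁ := 0)
      (c₁₁ := (7 * n - 10) / 12) (c₁ := (n - 1) * (7 * n ^ 2 - 13 * n + 4) / 12)
      (c₀ := n ^ 2 * (n - 1) ^ 2 * (3 * n - 5) / 24)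
      (fun m hm hm' hmn => by
        interval_cases m
        · have := binom_of_nat (n - 1) 1
          rw [Nat.choose_one_right, Nat.cast_sub hmn] at this
          push_cast at this ⊢
          norm_num at this ⊢
          linear_combination this
        · norm_num [binom]
        · rw [binom_of_neg _ (by norm_num)]
          norm_num)
      (by ring) (by ring) (by ring) (by ring) (by ring) (by ring) (by ring)
    rw [h, toRat]
    push_cast
    simp only [zero_smul, add_zero]
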